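/- **Setting.** Consider the system $x(t+1)=Ax(t)+Bu(t)+w(t)$, $y(t)=Cx(t)+v(t)$, $t\in\mathbb N$, with $x,w\in\mathbb R^{n_x}$, $u\in\mathbb R^{n_u}$, $y,v\in\mathbb R^{n_y}$, where $(A,B)$ is controllable and $(A,C)$ is observable. Norms are Euclidean (vectors) or spectral (matrices), and $\|z_t\|_\infty=\sup_{0\le s<t}\|z(s)\|$ (equal to $0$ for $t=0$). *Offline data.* Fix a length $T$, an initial state $x_0$ and an input sequence $u(0),u(1),\dots$ whose window $u(0),\dots,u(T-1)$ is persistently exciting of order $n_x+1$ (its Hankel matrix with $n_x+1$ block rows has rank $n_u(n_x+1)$). A record $x,u,y$ of the system with $x(0)=x_0$ and noise satisfying $\|w(t)\|\le\bar w$, $\|v(t)\|\le\bar v$ gives the matrices $X_0=[x(0)\cdots x(T-1)]$, $X_1=[x(1)\cdots x(T)]$, $U_0=[u(0)\cdots u(T-1)]$, $Y_0=[y(0)\cdots y(T-1)]$ and $\Phi_0=\begin{bmatrix}X_0\\U_0\end{bmatrix}$. *Programs.* Fix $W_x,W_u\succ0$, $N_x,N_y\succeq0$ and $\alpha_1,\alpha_2>0$.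 (a) Minimize $\gamma$ over $(\gamma,Q,P,G,M_1)$ subject to $X_1QP^{-1}Q'X_1'-P+I\preceq0$, $P\succeq I$, $G-U_0QP^{-1}Q'U_0'\succeq0$, $M_1-QP^{-1}Q'\succeq0$, $X_0Q=P$, $\mathrm{tr}(W_xP)+\mathrm{tr}(W_uG)+\alpha_1\mathrm{tr}(M_1)\le\gamma$. For an optimal solution put $\tilde K=U_0\tilde Q\tilde P^{-1}$. (b) Minimize $\rho$ over $(\rho,M_2,\Phi_1,\Phi_2)$ subject to $\Phi_0[\Phi_1\ \Phi_2]=I$, $\begin{bmatrix}M_2&\Phi_1'\\\Phi_1&I\end{bmatrix}\succeq0$, $\mathrm{tr}(M_2)\le\rho$. Let $(\tilde\Phi_1,\tilde\Phi_2)$ denote the corresponding part of an optimal solution. (c) Given $\tilde\Phi_1$, minimize $\epsilon$ over $(\epsilon,\Pi,\Sigma,\Upsilon)$ subject to $\tilde\Phi_1'(\Sigma X_1-\Pi Y_0)'\Sigma^{-1}(\Sigma X_1-\Pi Y_0)\tilde\Phi_1-\Sigma+I\preceq0$, $\Sigma\succeq I$, $\Upsilon-\Pi'\Sigma^{-1}\Pi\succeq0$,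 $\mathrm{tr}(N_x\Sigma)+\mathrm{tr}(N_y\Upsilon)+\alpha_2(\|\Upsilon\|+\|\Sigma\|+\|\Pi\|)\le\epsilon$. For an optimal solution put $\tilde L=\tilde\Sigma^{-1}\tilde\Pi$. *Closed loop.* The system is operated, from an arbitrary new initial state $x(0)$, with the controller $$\hat x(t+1)=(X_1\tilde\Phi_1+X_1\tilde\Phi_2\tilde K-\tilde LY_0\tilde\Phi_1)\hat x(t)+\tilde Ly(t),\qquad u(t)=\tilde K\hat x(t),\qquad \hat x(0)=0.$$ *Stability notions.* A function $\pi:[0,\infty)\to[0,\infty)$ is of class $\mathcal K$ if it is continuous and strictly increasing with $\pi(0)=0$; $\phi(s,t)$ is of class $\mathcal{KL}$ if $\phi(\cdot,t)\in\mathcal K$ for each $t\in\mathbb N$ and $\phi(s,\cdot)$ decreases to $0$ for each $s\ge0$. The estimator is **RGES** if there are $\phi\in\mathcal{KL}$, $\pi_w,\pi_v\in\mathcal K$ such that, for every $x(0)$ and all online noises with $\|w(t)\|\le\bar w$, $\|v(t)\|\le\bar v$, $$\|x(t)-\hat x(t)\|\le\phi(\|x(0)-\hat x(0)\|,t)+\pi_w(\|w_t\|_\infty)+\pi_v(\|v_t\|_\infty)\quad\text{for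 all }t\in\mathbb N.$$ The closed loop is **ISpS** with respect to $w$ if there are $\phi\in\mathcal{KL}$, $\pi_w\in\mathcal K$ and a constant $D_0$ such that, for every $x(0)$, every bounded $w$ and every $v$ with $\|v(t)\|\le\bar v$, $\|x(t)\|\le\phi(\|x(0)\|,t)+\pi_w(\|w_t\|_\infty)+D_0$ for all $t\in\mathbb N$. **Theorem.** There is $R_0$ such that for every $R\ge R_0$ there is $\delta>0$ such that, for all $\bar w,\bar v\ge0$ with $\max\{\bar w,\bar v\}\le\delta$ and every offline record as above with noise bounded by $\bar w,\bar v$: 1. $\mathrm{rank}\,\Phi_0=n_x+n_u$; 2. program (a) is feasible and has an optimal solution; program (b) is feasible and has an optimal solution with $\|\tilde\Phi_2\|\le R$; for every optimal solution of (b), program (c) is feasible and has an optimal solution; 3. for every optimal solution of (a), every optimal solution of (b) with $\|\tilde\Phi_2\|\le R$, and every optimal solution of the resulting program (c), the estimator is RGES and the closed loop is ISpS with respect to $w$. -/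

import Mathlib

open Filter Topology

noncomputable section

namespace DDLQG

/-- `ℝⁿ` with the Euclidean norm. -/
abbrev Vec (n : ℕ) : Type := EuclideanSpace ℝ (Fin n)

/-- The spectral norm of a real matrix (operator norm between Euclidean spaces). -/
def specNorm {m n : Type*} [Fintype m] [Fintype n] [DecidableEq n] (M : Matrix m n ℝ) : ℝ :=
  ‖(Matrix.toEuclideanLin M).toContinuousLinearMap‖

/-- The matrix-vector product `M x`. -/
def act {m n : ℕ} (M : Matrix (Fin m) (Fin n) ℝ) (x : Vec n) : Vec m :=
  Matrix.toEuclideanLin M x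

/-! ### The linear system and its structural properties -/

/-- `x(t+1) = A x(t) + B u(t) + w(t)`, `y(t) = C x(t) + v(t)` for all `t`. -/
def IsTrajectory {nx nu ny : ℕ} (A : Matrix (Fin nx) (Fin nx) ℝ) (B : Matrix (Fin nx) (Fin nu) ℝ)
    (C : Matrix (Fin ny) (Fin nx) ℝ) (x : ℕ → Vec nx) (u : ℕ → Vec nu) (y : ℕ → Vec ny)
    (w : ℕ → Vec nx) (v : ℕ → Vec ny) : Prop :=
  ∀ t, x (t + 1) = act A (x t) + act B (u t) + w t ∧ y t = act C (x t) + v t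

/-- `(A, B)` is controllable: `[B, AB, …, A^{n-1} B]` has rank `n`. -/
def Controllable {nx nu : ℕ} (A : Matrix (Fin nx) (Fin nx) ℝ)
    (B : Matrix (Fin nx) (Fin nu) ℝ) : Prop :=
  (Matrix.of fun (i : Fin nx) (k : Fin nx × Fin nu) => (A ^ (k.1 : ℕ) * B) i k.2).rank = nx

/-- `(A, C)` is observable: the stack of `C, CA, …, C A^{n-1}` has rank `n`. -/
def Observable {nx ny : ℕ} (A : Matrix (Fin nx) (Fin nx) ℝ)
    (C : Matrix (Fin ny) (Fin nx) ℝ) : Prop :=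
  (Matrix.of fun (k : Fin nx × Fin ny) (j : Fin nx) => (C * A ^ (k.1 : ℕ)) k.2 j).rank = nx

/-- The Hankel matrix with `L` block rows of `z(0), …, z(T-1)`; it has `T - L + 1` columns
(none if `T < L`). -/
def hankel {n : ℕ} (L T : ℕ) (z : ℕ → Vec n) : Matrix (Fin L × Fin n) (Fin (T + 1 - L)) ℝ :=
  Matrix.of fun k j => z (k.1 + j) k.2

/-- `z(0), …, z(T-1)` is persistently exciting of order `L`. -/
def PersistentlyExciting {n : ℕ} (L T : ℕ) (z : ℕ → Vec n) : Prop :=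
  (hankel L T z).rank = n * L

/-- All values of the sequence lie in the closed ball of radius `r` around `0`. -/
def BoundedBy {n : ℕ} (r : ℝ) (z : ℕ → Vec n) : Prop := ∀ t, ‖z t‖ ≤ r

/-! ### Offline data -/

/-- The matrix `[z(s)  z(s+1)  …  z(s+T-1)]`. -/
def window {n : ℕ} (T s : ℕ) (z : ℕ → Vec n) : Matrix (Fin n) (Fin T) ℝ :=
  Matrix.of fun i j => z (s + j) i

/-- The four data matrices available for design. -/
structure Data (T nx nu ny : ℕ) where
  X0 : Matrix (Fin nx) (Fin T) ℝ
  X1 : Matrix (Fin nx) (Fin T) ℝ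
  U0 : Matrix (Fin nu) (Fin T) ℝ
  Y0 : Matrix (Fin ny) (Fin T) ℝ

/-- The data matrices of a recorded state, input and output sequence. -/
def Data.ofTraj {nx nu ny : ℕ} (T : ℕ) (x : ℕ → Vec nx) (u : ℕ → Vec nu) (y : ℕ → Vec ny) :
    Data T nx nu ny where
  X0 := window T 0 x
  X1 := window T 1 x
  U0 := window T 0 u
  Y0 := window T 0 y

/-- `Φ₀ = [X₀; U₀]`. -/
def Data.Phi0 {T nx nu ny : ℕ} (D : Data T nx nu ny) : Matrix (Fin nx ⊕ Fin nu) (Fin T) ℝ :=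
  Matrix.fromRows D.X0 D.U0

/-! ### The three semidefinite programs -/

/-- `s` is an optimal solution of: minimize `obj` over the points satisfying `feas`. -/
def IsOptimal {α : Type*} (feas : α → Prop) (obj : α → ℝ) (s : α) : Prop :=
  feas s ∧ ∀ s', feas s' → obj s ≤ obj s'

/-- Decision variables of the state-feedback program. -/
structure LQRVar (T nx nu : ℕ) where
  γ : ℝ
  Q : Matrix (Fin T) (Fin nx) ℝ
  P : Matrix (Fin nx) (Fin nx) ℝ
  G : Matrix (Fin nu) (Fin nu) ℝ
  M₁ : Matrix (Fin T) (Fin T) ℝ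

/-- Constraints of the state-feedback program. -/
structure LQRFeasible {T nx nu ny : ℕ} (D : Data T nx nu ny) (Wx : Matrix (Fin nx) (Fin nx) ℝ)
    (Wu : Matrix (Fin nu) (Fin nu) ℝ) (α₁ : ℝ) (s : LQRVar T nx nu) : Prop where
  lyap : (-(D.X1 * s.Q * s.P⁻¹ * s.Q.transpose * D.X1.transpose - s.P + 1)).PosSemidef
  P_ge : (s.P - 1).PosSemidef
  G_ge : (s.G - D.U0 * s.Q * s.P⁻¹ * s.Q.transpose * D.U0.transpose).PosSemidef
  M₁_ge : (s.M₁ - s.Q * s.P⁻¹ * s.Q.transpose).PosSemidef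
  X0_Q : D.X0 * s.Q = s.P
  cost : (Wx * s.P).trace + (Wu * s.G).trace + α₁ * s.M₁.trace ≤ s.γ

/-- The controller gain `K = U₀ Q P⁻¹`. -/
def LQRVar.gain {T nx nu ny : ℕ} (D : Data T nx nu ny) (s : LQRVar T nx nu) :
    Matrix (Fin nu) (Fin nx) ℝ :=
  D.U0 * s.Q * s.P⁻¹

/-- Decision variables of the program that selects a right inverse of `Φ₀`. -/
structure PhiVar (T nx nu : ℕ) where
  ρ : ℝ
  M₂ : Matrix (Fin nx) (Fin nx) ℝ
  Φ₁ : Matrix (Fin T) (Fin nx) ℝ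
  Φ₂ : Matrix (Fin T) (Fin nu) ℝ

/-- Constraints of the right-inverse program. -/
structure PhiFeasible {T nx nu ny : ℕ} (D : Data T nx nu ny) (s : PhiVar T nx nu) : Prop where
  rightInv : D.Phi0 * Matrix.fromCols s.Φ₁ s.Φ₂ = 1
  block : (Matrix.fromBlocks s.M₂ s.Φ₁.transpose s.Φ₁ 1).PosSemidef
  cost : s.M₂.trace ≤ s.ρ

/-- Decision variables of the observer program. -/
structure LQGVar (nx ny : ℕ) where
  ε : ℝ
  Pi : Matrix (Fin nx) (Fin ny) ℝ
  Sig : Matrix (Fin nx) (Fin nx) ℝ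
  Ups : Matrix (Fin ny) (Fin ny) ℝ

/-- Constraints of the observer program, for a given `Φ₁`. -/
structure LQGFeasible {T nx nu ny : ℕ} (D : Data T nx nu ny) (Φ₁ : Matrix (Fin T) (Fin nx) ℝ)
    (Nx : Matrix (Fin nx) (Fin nx) ℝ) (Ny : Matrix (Fin ny) (Fin ny) ℝ) (α₂ : ℝ)
    (s : LQGVar nx ny) : Prop where
  lyap : (-(Φ₁.transpose * (s.Sig * D.X1 - s.Pi * D.Y0).transpose * s.Sig⁻¹ *
      (s.Sig * D.X1 - s.Pi * D.Y0) * Φ₁ - s.Sig + 1)).PosSemidef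
  Sig_ge : (s.Sig - 1).PosSemidef
  Ups_ge : (s.Ups - s.Pi.transpose * s.Sig⁻¹ * s.Pi).PosSemidef
  cost : (Nx * s.Sig).trace + (Ny * s.Ups).trace
      + α₂ * (specNorm s.Ups + specNorm s.Sig + specNorm s.Pi) ≤ s.ε

/-- The observer gain `L = Σ⁻¹ Π`. -/
def LQGVar.gain {nx ny : ℕ} (s : LQGVar nx ny) : Matrix (Fin nx) (Fin ny) ℝ :=
  s.Sig⁻¹ * s.Pi

/-! ### The data-driven closed loop -/

/-- The data-driven output-feedback controller, started at `x̂(0) = 0`: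
`x̂(t+1) = (X₁Φ₁ + X₁Φ₂K - L Y₀Φ₁) x̂(t) + L y(t)` and `u(t) = K x̂(t)`. -/
def IsController {T nx nu ny : ℕ} (D : Data T nx nu ny) (Φ₁ : Matrix (Fin T) (Fin nx) ℝ)
    (Φ₂ : Matrix (Fin T) (Fin nu) ℝ) (K : Matrix (Fin nu) (Fin nx) ℝ)
    (L : Matrix (Fin nx) (Fin ny) ℝ) (xh : ℕ → Vec nx) (u : ℕ → Vec nu) (y : ℕ → Vec ny) : Prop :=
  xh 0 = 0 ∧ ∀ t,
    xh (t + 1) = act (D.X1 * Φ₁ + D.X1 * Φ₂ * K - L * D.Y0 * Φ₁) (xh t) + act L (y t) ∧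
    u t = act K (xh t)

/-- `x, x̂` solve the plant in feedback with the data-driven controller under noise `w, v`. -/
def ClosedLoop {T nx nu ny : ℕ} (A : Matrix (Fin nx) (Fin nx) ℝ) (B : Matrix (Fin nx) (Fin nu) ℝ)
    (C : Matrix (Fin ny) (Fin nx) ℝ) (D : Data T nx nu ny) (Φ₁ : Matrix (Fin T) (Fin nx) ℝ)
    (Φ₂ : Matrix (Fin T) (Fin nu) ℝ) (K : Matrix (Fin nu) (Fin nx) ℝ)
    (L : Matrix (Fin nx) (Fin ny) ℝ)
    (x xh : ℕ → Vec nx) (w : ℕ → Vec nx) (v : ℕ → Vec ny) : Prop :=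
  ∃ (u : ℕ → Vec nu) (y : ℕ → Vec ny),
    IsTrajectory A B C x u y w v ∧ IsController D Φ₁ Φ₂ K L xh u y

/-! ### Comparison functions and stability notions -/

/-- Class `𝒦` functions `[0,∞) → [0,∞)`. -/
structure ClassK (π : ℝ → ℝ) : Prop where
  cont : ContinuousOn π (Set.Ici 0)
  mono : StrictMonoOn π (Set.Ici 0)
  zero : π 0 = 0

/-- Class `𝒦ℒ` functions, with discrete time as second argument. -/
structure ClassKL (φ : ℝ → ℕ → ℝ) : Prop where
  classK : ∀ t, ClassK fun s => φ s t
  anti : ∀ s, 0 ≤ s → Antitone (φ s)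
  tendsto : ∀ s, 0 ≤ s → Tendsto (φ s) atTop (𝓝 0)

/-- `‖z_t‖_∞ = sup_{0 ≤ s < t} ‖z(s)‖`, equal to `0` for `t = 0`. -/
def supNorm {n : ℕ} (z : ℕ → Vec n) (t : ℕ) : ℝ := ⨆ s : Fin t, ‖z s‖

/-- Robust global exponential stability of the estimate `x̂` of `x`, in the `𝒦ℒ` form, along all
solutions `loop x x̂ w v` whose noises are bounded by `wbar` and `vbar`. -/
def RGES {nx ny : ℕ} (wbar vbar : ℝ)
    (loop : (ℕ → Vec nx) → (ℕ → Vec nx) → (ℕ → Vec nx) → (ℕ → Vec ny) → Prop) : Prop :=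
  ∃ (φ : ℝ → ℕ → ℝ) (πw πv : ℝ → ℝ), ClassKL φ ∧ ClassK πw ∧ ClassK πv ∧
    ∀ x xh w v, loop x xh w v → BoundedBy wbar w → BoundedBy vbar v →
      ∀ t, ‖x t - xh t‖ ≤ φ ‖x 0 - xh 0‖ t + πw (supNorm w t) + πv (supNorm v t)

/-- Input-to-state practical stability of the state `x` with respect to the input `w`: all bounded
`w` are allowed, the measurement noise is any sequence bounded by `vbar`. -/
def ISpS {nx ny : ℕ} (vbar : ℝ)
    (loop : (ℕ → Vec nx) → (ℕ → Vec nx) → (ℕ → Vec nx) → (ℕ → Vec ny) → Prop) : Prop :=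
  ∃ (φ : ℝ → ℕ → ℝ) (πw : ℝ → ℝ) (D₀ : ℝ), ClassKL φ ∧ ClassK πw ∧
    ∀ x xh w v, loop x xh w v → (∃ c, BoundedBy c w) → BoundedBy vbar v →
      ∀ t, ‖x t‖ ≤ φ ‖x 0‖ t + πw (supNorm w t) + D₀

end DDLQG

end

/-!
Once the noise is small, the three programs certify stability of matrices that differ from those of
the true closed loop only by terms linear in the offline noise, and all constants can be chosen
uniformly over the records.

*Full rank.* A left annihilator `(ξ, η)` of the noise-free samples, combined over `n + 1` consecutive
times with the coefficients of the characteristic polynomial of `A`, annihilates the Hankel matrix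
of the input, hence vanishes (`eq_zero_of_annihilates_samples`). The noisy `Φ₀` is a small
perturbation, so it has a right inverse `[Φ₁ Φ₂]` with blocks bounded by a
constant `r` (`exists_uniform_right_inverse`); this `r` is the threshold for `R`.

*Feasibility with bounded cost.* Controllability steers every initial state to the origin by inputs
linear in that state. Regressing these inputs on the states gives a stabilising gain together with a
certificate `F P Fᵀ ⪯ P - 1`, since `P - 1 - F P Fᵀ` is a sum of squares of regression residuals
(`Controllable.exists_lyapunov`); the observer gain is obtained by duality. Doubling the certificate
leaves room for a small perturbation (`exists_lyapunov_margin`), which makes it feasible for the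
programs built from noisy data, at a cost bounded independently of the record. Optimal solutions
therefore obey the same cost bounds; they exist because the sublevel sets are compact.

*Stability.* For optimal solutions put `S = Q P⁻¹`, `F = X₁ S` and `E = (X₁ - L Y₀) Φ₁`. The
constraints say `F P Fᵀ ⪯ P - 1` and `Eᵀ Σ E ⪯ Σ - 1`, so both matrices contract norms that are
equivalent to the Euclidean one with a uniform constant. The error `x - x̂` and the estimate `x̂` obey
the cascade `e ↦ E e`, `x̂ ↦ F x̂ + L C e` up to coupling terms linear in the offline noise
(`ClosedLoop.cascade`). A weighted sum of the two norms then decays geometrically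
(`exists_uniform_decay`), and the resulting linear bound gives both stability notions
(`rges_and_isps_of_bound`).
-/

set_option linter.unusedSectionVars false

namespace DDLQG

open Matrix
open scoped Matrix.Norms.L2Operator

/-! ### Real positive semidefinite matrices and the spectral norm -/

section Norm

variable {m n : Type*} [Fintype m] [Fintype n] [DecidableEq m] [DecidableEq n]

lemma specNorm_eq_norm (M : Matrix m n ℝ) : specNorm M = ‖M‖ := rfl

lemma norm_transpose (M : Matrix m n ℝ) : ‖Mᵀ‖ = ‖M‖ := by
  rw [← conjTranspose_eq_transpose_of_trivial]
  exact l2_opNorm_conjTranspose M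

lemma norm_transpose_mul_self (M : Matrix m n ℝ) : ‖Mᵀ * M‖ = ‖M‖ ^ 2 := by
  rw [← conjTranspose_eq_transpose_of_trivial, l2_opNorm_conjTranspose_mul_self, sq]

lemma norm_mul_transpose_self (M : Matrix m n ℝ) : ‖M * Mᵀ‖ = ‖M‖ ^ 2 := by
  simpa [norm_transpose] using norm_transpose_mul_self Mᵀ

lemma norm_one_le : ‖(1 : Matrix n n ℝ)‖ ≤ 1 := by
  have h := norm_transpose_mul_self (1 : Matrix n n ℝ)
  rw [transpose_one, Matrix.mul_one] at h
  nlinarith [norm_nonneg (1 : Matrix n n ℝ)]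

lemma norm_toLp_mulVec_le (M : Matrix m n ℝ) (x : n → ℝ) :
    ‖WithLp.toLp 2 (M *ᵥ x)‖ ≤ ‖M‖ * ‖WithLp.toLp 2 x‖ :=
  l2_opNorm_mulVec M (WithLp.toLp 2 x)

lemma norm_le_of_forall_mulVec (M : Matrix m n ℝ) {c : ℝ} (hc : 0 ≤ c)
    (h : ∀ x : n → ℝ, ‖WithLp.toLp 2 (M *ᵥ x)‖ ≤ c * ‖WithLp.toLp 2 x‖) : ‖M‖ ≤ c :=
  ContinuousLinearMap.opNorm_le_bound _ hc fun x => h x.ofLp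

lemma norm_sq_toLp (x : n → ℝ) : ‖WithLp.toLp 2 x‖ ^ 2 = x ⬝ᵥ x := by
  rw [EuclideanSpace.norm_sq_eq]
  simp [dotProduct, sq]

lemma posSemidef_real_iff {M : Matrix n n ℝ} :
    M.PosSemidef ↔ Mᵀ = M ∧ ∀ x : n → ℝ, 0 ≤ x ⬝ᵥ M *ᵥ x := by
  rw [posSemidef_iff_dotProduct_mulVec]
  simp [Matrix.IsHermitian, conjTranspose_eq_transpose_of_trivial]

lemma PosSemidef.transpose_eq {M : Matrix n n ℝ} (h : M.PosSemidef) : Mᵀ = M :=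
  (posSemidef_real_iff.1 h).1

lemma PosSemidef.conj_mul {M : Matrix n n ℝ} (h : M.PosSemidef) (B : Matrix m n ℝ) :
    (B * M * Bᵀ).PosSemidef := by
  simpa using h.mul_mul_conjTranspose_same B

lemma PosSemidef.sub_trans {M N K : Matrix n n ℝ} (h : (M - N).PosSemidef)
    (h' : (N - K).PosSemidef) : (M - K).PosSemidef := by
  simpa using h.add h'

lemma posSemidef_self_mul_transpose (B : Matrix m n ℝ) : (B * Bᵀ).PosSemidef := by
  simpa using posSemidef_self_mul_conjTranspose B

open scoped MatrixOrder in
/-- A real positive semidefinite matrix is of the form `R Rᵀ` with `R` square. -/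
lemma PosSemidef.exists_mul_transpose {M : Matrix n n ℝ} (h : M.PosSemidef) :
    ∃ R : Matrix n n ℝ, M = R * Rᵀ := by
  have h0 : 0 ≤ M := Matrix.nonneg_iff_posSemidef.2 h
  refine ⟨CFC.sqrt M, ?_⟩
  have hs : (CFC.sqrt M)ᵀ = CFC.sqrt M :=
    PosSemidef.transpose_eq (Matrix.nonneg_iff_posSemidef.1 (CFC.sqrt_nonneg M))
  rw [hs, CFC.sqrt_mul_sqrt_self M h0]

lemma posSemidef_smul_one_sub {M : Matrix n n ℝ} (hM : Mᵀ = M) {c : ℝ} (hc : ‖M‖ ≤ c) :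
    (c • (1 : Matrix n n ℝ) - M).PosSemidef := by
  refine posSemidef_real_iff.2 ⟨by simp [hM], fun x => ?_⟩
  have h1 : x ⬝ᵥ M *ᵥ x ≤ c * (x ⬝ᵥ x) := by
    have h2 : x ⬝ᵥ M *ᵥ x = inner ℝ (WithLp.toLp 2 (M *ᵥ x)) (WithLp.toLp 2 x) := by
      simp [EuclideanSpace.inner_eq_star_dotProduct]
    rw [h2, ← norm_sq_toLp]
    calc _ ≤ ‖WithLp.toLp 2 (M *ᵥ x)‖ * ‖WithLp.toLp 2 x‖ := real_inner_le_norm _ _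
      _ ≤ (‖M‖ * ‖WithLp.toLp 2 x‖) * ‖WithLp.toLp 2 x‖ := by
          gcongr; exact norm_toLp_mulVec_le M x
      _ ≤ (c * ‖WithLp.toLp 2 x‖) * ‖WithLp.toLp 2 x‖ := by gcongr
      _ = _ := by ring
  simp only [Matrix.sub_mulVec, Matrix.smul_mulVec, Matrix.one_mulVec, dotProduct_sub,
    dotProduct_smul, smul_eq_mul]
  linarith

lemma norm_sq_le_trace_mul_transpose (B : Matrix m n ℝ) : ‖B‖ ^ 2 ≤ (B * Bᵀ).trace := by
  have h0 : (B * Bᵀ).trace = ∑ i, ‖WithLp.toLp 2 (B i)‖ ^ 2 := by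
    simp [trace, norm_sq_toLp, Matrix.mul_apply, dotProduct]
  have hn : 0 ≤ (B * Bᵀ).trace := by rw [h0]; positivity
  rw [← Real.le_sqrt (norm_nonneg _) hn]
  refine norm_le_of_forall_mulVec B (Real.sqrt_nonneg _) fun x => ?_
  refine abs_le_of_sq_le_sq' ?_ (by positivity) |>.2
  rw [mul_pow, Real.sq_sqrt hn, h0, EuclideanSpace.norm_sq_eq, Finset.sum_mul]
  refine Finset.sum_le_sum fun i _ => ?_
  have h2 : (B *ᵥ x) i = inner ℝ (WithLp.toLp 2 x) (WithLp.toLp 2 (B i)) := by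
    simp [EuclideanSpace.inner_eq_star_dotProduct, mulVec]
  rw [← mul_pow]
  refine pow_le_pow_left₀ (norm_nonneg _) ?_ 2
  simp only [h2]
  rw [mul_comm]
  exact norm_inner_le_norm _ _

lemma PosSemidef.norm_le_trace {M : Matrix n n ℝ} (h : M.PosSemidef) : ‖M‖ ≤ M.trace := by
  obtain ⟨R, rfl⟩ := PosSemidef.exists_mul_transpose h
  rw [norm_mul_transpose_self]
  exact norm_sq_le_trace_mul_transpose R

lemma PosSemidef.trace_mul_nonneg {M N : Matrix n n ℝ} (hM : M.PosSemidef) (hN : N.PosSemidef) :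
    0 ≤ (M * N).trace := by
  obtain ⟨R, rfl⟩ := PosSemidef.exists_mul_transpose hN
  rw [← Matrix.mul_assoc, Matrix.trace_mul_comm, ← Matrix.mul_assoc]
  have := PosSemidef.conj_mul hM Rᵀ
  rw [transpose_transpose] at this
  exact this.trace_nonneg

lemma trace_le_trace_of_sub {M N : Matrix n n ℝ} (h : (M - N).PosSemidef) :
    N.trace ≤ M.trace := by
  have := h.trace_nonneg
  rw [trace_sub] at this
  linarith

lemma PosSemidef.norm_le_of_sub {M : Matrix n n ℝ} (h : M.PosSemidef) {c : ℝ} (hc : 0 ≤ c)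
    (h' : (c • (1 : Matrix n n ℝ) - M).PosSemidef) : ‖M‖ ≤ c := by
  obtain ⟨R, rfl⟩ := PosSemidef.exists_mul_transpose h
  rw [norm_mul_transpose_self, ← norm_transpose R]
  have : ‖Rᵀ‖ ≤ √c := by
    refine norm_le_of_forall_mulVec _ (Real.sqrt_nonneg _) fun x => ?_
    refine abs_le_of_sq_le_sq' ?_ (by positivity) |>.2
    rw [mul_pow, Real.sq_sqrt hc, norm_sq_toLp, norm_sq_toLp]
    have := (posSemidef_real_iff.1 h').2 x
    simp only [Matrix.sub_mulVec, Matrix.smul_mulVec, Matrix.one_mulVec, dotProduct_sub,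
      dotProduct_smul, smul_eq_mul, ← Matrix.mulVec_mulVec] at this
    rw [Matrix.dotProduct_mulVec x R, ← Matrix.mulVec_transpose] at this
    linarith
  calc _ ≤ √c ^ 2 := pow_le_pow_left₀ (norm_nonneg _) this 2
    _ = c := Real.sq_sqrt hc

/-- Matrices dominating the identity are positive definite. -/
lemma posDef_of_sub_one {P : Matrix n n ℝ} (h : (P - 1).PosSemidef) : P.PosDef := by
  simpa using PosDef.posSemidef_add h PosDef.one

lemma isUnit_det_of_sub_one {P : Matrix n n ℝ} (h : (P - 1).PosSemidef) : IsUnit P.det :=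
  (Matrix.isUnit_iff_isUnit_det P).1 (posDef_of_sub_one h).isUnit

lemma posSemidef_one_sub_inv {P : Matrix n n ℝ} (h : (P - 1).PosSemidef) :
    (1 - P⁻¹).PosSemidef := by
  have hP := posDef_of_sub_one h
  have hu := isUnit_det_of_sub_one h
  obtain ⟨R, hR⟩ := PosSemidef.exists_mul_transpose hP.inv.posSemidef
  -- with `P⁻¹ = R Rᵀ`, the congruence `Rᵀ (P - 1) R ⪰ 0` says `Rᵀ R ⪯ 1`, and `‖R Rᵀ‖ = ‖Rᵀ R‖`
  have hPR : P * (R * Rᵀ) = 1 := by rw [← hR]; exact Matrix.mul_nonsing_inv P hu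
  have hPs : (P⁻¹)ᵀ = P⁻¹ := PosSemidef.transpose_eq hP.inv.posSemidef
  have h1 : ‖Rᵀ * R‖ ≤ 1 := by
    have hR1 : Rᵀ * P * R = 1 := by
      have : (Rᵀ * P) * R = 1 ↔ R * (Rᵀ * P) = 1 := mul_eq_one_comm
      rw [this, ← Matrix.mul_assoc, mul_eq_one_comm, hPR]
    have h2 := PosSemidef.conj_mul h Rᵀ
    rw [transpose_transpose, Matrix.mul_sub, Matrix.sub_mul, hR1, Matrix.mul_one] at h2
    have h3 := posSemidef_self_mul_transpose Rᵀ
    rw [transpose_transpose] at h3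
    exact PosSemidef.norm_le_of_sub h3 zero_le_one (by simpa using h2)
  rw [norm_transpose_mul_self, ← norm_mul_transpose_self, ← hR] at h1
  simpa using posSemidef_smul_one_sub hPs h1

lemma norm_inv_le_one {P : Matrix n n ℝ} (h : (P - 1).PosSemidef) : ‖P⁻¹‖ ≤ 1 :=
  PosSemidef.norm_le_of_sub (posDef_of_sub_one h).inv.posSemidef zero_le_one
    (by simpa using posSemidef_one_sub_inv h)

/-- A positive definite weight controls the trace of positive semidefinite matrices. -/
lemma PosDef.exists_trace_le {W : Matrix n n ℝ} (hW : W.PosDef) :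
    ∃ c : ℝ, 0 < c ∧ ∀ P : Matrix n n ℝ, P.PosSemidef → P.trace ≤ c * (W * P).trace := by
  obtain ⟨Q, hQ⟩ := PosSemidef.exists_mul_transpose hW.posSemidef
  have hu : IsUnit W.det := (Matrix.isUnit_iff_isUnit_det W).1 hW.isUnit
  have huQ : IsUnit Q.det := by
    rw [hQ, det_mul] at hu
    exact isUnit_of_mul_isUnit_left hu
  set N := (Qᵀ * Q)⁻¹ with hN
  have hNQ : Q * N * Qᵀ = 1 := by
    rw [hN, Matrix.mul_inv_rev, ← Matrix.mul_assoc, Matrix.mul_nonsing_inv Q huQ, Matrix.one_mul,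
      Matrix.nonsing_inv_mul _ (by rwa [det_transpose])]
  have hNs : Nᵀ = N := by rw [hN, transpose_nonsing_inv, transpose_mul, transpose_transpose]
  refine ⟨‖N‖ + 1, by positivity, fun P hP => ?_⟩
  have h1 : ((‖N‖ + 1) • (1 : Matrix n n ℝ) - N).PosSemidef :=
    posSemidef_smul_one_sub hNs (by simp)
  have h2 := PosSemidef.conj_mul hP Qᵀ
  have h3 := PosSemidef.trace_mul_nonneg h1 h2
  have e1 : (Qᵀ * P * Qᵀᵀ).trace = (W * P).trace := by
    rw [transpose_transpose, Matrix.trace_mul_comm, ← Matrix.mul_assoc, ← hQ]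
  have e2 : (N * (Qᵀ * P * Qᵀᵀ)).trace = P.trace := by
    rw [transpose_transpose, ← Matrix.mul_assoc, Matrix.trace_mul_comm, ← Matrix.mul_assoc,
      ← Matrix.mul_assoc, hNQ, Matrix.one_mul]
  rw [Matrix.sub_mul, trace_sub, Matrix.smul_mul, trace_smul, Matrix.one_mul, e1, e2,
    smul_eq_mul] at h3
  linarith

end Norm

/-! ### Full row rank, right inverses and their perturbation -/

section RightInverse

variable {m n : Type*} [Fintype m] [Fintype n] [DecidableEq m] [DecidableEq n]

lemma rank_eq_card_of_right_inverse {M : Matrix m n ℝ} {N : Matrix n m ℝ} (h : M * N = 1) :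
    M.rank = Fintype.card m := by
  refine le_antisymm (rank_le_card_height M) ?_
  calc Fintype.card m = (1 : Matrix m m ℝ).rank := rank_one.symm
    _ ≤ M.rank := by rw [← h]; exact rank_mul_le_left M N

lemma exists_right_inverse_of_rank {M : Matrix m n ℝ} (h : M.rank = Fintype.card m) :
    ∃ N : Matrix n m ℝ, M * N = 1 := by
  refine Matrix.mulVec_surjective_iff_exists_right_inverse.1 ?_
  have h1 : LinearMap.range M.mulVecLin = ⊤ :=
    Submodule.eq_top_of_finrank_eq (by rw [Module.finrank_fintype_fun_eq_card]; exact h)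
  exact LinearMap.range_eq_top.1 h1

lemma eq_zero_of_vecMul_eq_zero_of_rank {M : Matrix m n ℝ} (h : M.rank = Fintype.card m)
    {a : m → ℝ} (ha : a ᵥ* M = 0) : a = 0 := by
  obtain ⟨N, hN⟩ := exists_right_inverse_of_rank h
  rw [← Matrix.vecMul_one a, ← hN, ← Matrix.vecMul_vecMul, ha, Matrix.zero_vecMul]

lemma exists_right_inverse_of_vecMul {M : Matrix m n ℝ} (h : ∀ a, a ᵥ* M = 0 → a = 0) :
    ∃ N : Matrix n m ℝ, M * N = 1 := by
  refine exists_right_inverse_of_rank (LinearIndependent.rank_matrix ?_)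
  rw [← Matrix.vecMul_injective_iff]
  intro a b hab
  have := h (a - b) (by rw [Matrix.sub_vecMul]; simpa [sub_eq_zero] using hab)
  exact sub_eq_zero.1 this

/-- Having a right inverse is an open condition, with a locally bounded choice of the inverse. -/
lemma exists_right_inverse_of_near {M : Matrix m n ℝ} {N : Matrix n m ℝ} (h : M * N = 1) :
    ∃ η : ℝ, 0 < η ∧ ∀ M' : Matrix m n ℝ, ‖M' - M‖ ≤ η →
      ∃ N' : Matrix n m ℝ, M' * N' = 1 ∧ ‖N'‖ ≤ 2 * ‖N‖ := by
  refine ⟨1 / (2 * (‖N‖ + 1)), by positivity, fun M' hM' => ?_⟩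
  have ht : ‖(M - M') * N‖ ≤ 1 / 2 := by
    calc ‖(M - M') * N‖ ≤ ‖M - M'‖ * ‖N‖ := l2_opNorm_mul _ _
      _ ≤ 1 / (2 * (‖N‖ + 1)) * (‖N‖ + 1) := by
          rw [norm_sub_rev]; gcongr; linarith
      _ = 1 / 2 := by field_simp
  have hM'N : M' * N = 1 - (M - M') * N := by rw [Matrix.sub_mul, h]; abel
  have : CompleteSpace (Matrix m m ℝ) := FiniteDimensional.complete ℝ _
  obtain ⟨U, hU⟩ := isUnit_one_sub_of_norm_lt_one (x := (M - M') * N) (by linarith)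
  set X : Matrix m m ℝ := ↑U⁻¹ with hX
  have hUX : (1 - (M - M') * N) * X = 1 := by rw [← hU, hX]; exact U.mul_inv
  have hXe : X = 1 + (M - M') * N * X := by
    rw [Matrix.sub_mul, Matrix.one_mul] at hUX
    rw [← hUX]; abel
  have hXn : ‖X‖ ≤ 2 := by
    have h1 : ‖X‖ ≤ 1 + 1 / 2 * ‖X‖ := by
      calc ‖X‖ = ‖1 + (M - M') * N * X‖ := by rw [← hXe]
        _ ≤ ‖(1 : Matrix m m ℝ)‖ + ‖(M - M') * N‖ * ‖X‖ :=
          (norm_add_le _ _).trans (by gcongr; exact l2_opNorm_mul _ _)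
        _ ≤ 1 + 1 / 2 * ‖X‖ := by gcongr; exact norm_one_le
    linarith
  refine ⟨N * X, by rw [← Matrix.mul_assoc, hM'N, hUX], ?_⟩
  calc ‖N * X‖ ≤ ‖N‖ * ‖X‖ := l2_opNorm_mul _ _
    _ ≤ ‖N‖ * 2 := by gcongr
    _ = _ := mul_comm _ _

end RightInverse

/-! ### Persistency of excitation implies full row rank of the noise-free data -/

section Fundamental

variable {nx nu : ℕ} {A : Matrix (Fin nx) (Fin nx) ℝ} {B : Matrix (Fin nx) (Fin nu) ℝ}

lemma Controllable.eq_zero_of_vecMul (h : Controllable A B) {ξ : Fin nx → ℝ}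
    (hξ : ∀ k < nx, ξ ᵥ* (A ^ k * B) = 0) : ξ = 0 := by
  refine eq_zero_of_vecMul_eq_zero_of_rank (by simpa [Controllable] using h) ?_
  ext ⟨k, i⟩
  exact congrFun (hξ k k.2) i

lemma state_add_eq {x : ℕ → Fin nx → ℝ} {u : ℕ → Fin nu → ℝ}
    (hx : ∀ t, x (t + 1) = A *ᵥ x t + B *ᵥ u t) (t j : ℕ) :
    x (t + j) = (A ^ j) *ᵥ x t
      + ∑ i ∈ Finset.range j, (A ^ (j - 1 - i) * B) *ᵥ u (t + i) := by
  induction j with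
  | zero => simp
  | succ j ih =>
    rw [← add_assoc, hx, ih, Finset.sum_range_succ, Matrix.mulVec_add, Matrix.mulVec_mulVec,
      ← pow_succ', Matrix.mulVec_sum, add_assoc]
    congr 2
    · refine Finset.sum_congr rfl fun i hi => ?_
      have : j + 1 - 1 - i = (j - 1 - i) + 1 := by
        have := Finset.mem_range.1 hi; omega
      rw [this, Matrix.mulVec_mulVec, ← Matrix.mul_assoc, pow_succ']
    · simp

/-- State form of Willems' fundamental lemma. A row vector `(ξ, η)` annihilating all samples
`(x(t), u(t))` yields, on combining `n + 1` consecutive samples with the coefficients of the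
characteristic polynomial of `A`, a row vector annihilating the Hankel matrix of the input, whose
vanishing forces first `η = 0` and then `ξ Aᵏ B = 0` for all `k < n`. -/
lemma eq_zero_of_annihilates_samples (hAB : Controllable A B) {T : ℕ} {x : ℕ → Fin nx → ℝ}
    {u : ℕ → Vec nu} (hx : ∀ t, x (t + 1) = A *ᵥ x t + B *ᵥ (u t).ofLp)
    (hPE : PersistentlyExciting (nx + 1) T u) {ξ : Fin nx → ℝ} {η : Fin nu → ℝ}
    (h : ∀ t < T, ξ ⬝ᵥ x t + η ⬝ᵥ (u t).ofLp = 0) : ξ = 0 ∧ η = 0 := by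
  set p : ℕ → ℝ := fun j => A.charpoly.coeff j with hp
  have hdeg : A.charpoly.natDegree = nx := by simp [Matrix.charpoly_natDegree_eq_dim]
  have hpn : p nx = 1 := by
    have := (Matrix.charpoly_monic A).coeff_natDegree
    rwa [hdeg] at this
  have hCH : ∑ j ∈ Finset.range (nx + 1), p j • A ^ j = 0 := by
    have := Matrix.aeval_self_charpoly A
    rwa [Polynomial.aeval_eq_sum_range, hdeg] at this
  set r : ℕ → Fin nu → ℝ := fun k => ξ ᵥ* (A ^ k * B) with hr
  set a : Fin (nx + 1) × Fin nu → ℝ := fun k => p k.1 * η k.2 +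
    ∑ j ∈ Finset.range (nx + 1), if (k.1 : ℕ) < j then p j * r (j - 1 - k.1) k.2 else 0 with ha
  have haH : a ᵥ* hankel (nx + 1) T u = 0 := by
    ext τ
    have hτ : (τ : ℕ) + nx < T := by have := τ.2; omega
    have e1 : (a ᵥ* hankel (nx + 1) T u) τ = ∑ i ∈ Finset.range (nx + 1),
        (p i * (η ⬝ᵥ (u (τ + i)).ofLp) + ∑ j ∈ Finset.range (nx + 1),
          if i < j then p j * (r (j - 1 - i) ⬝ᵥ (u (τ + i)).ofLp) else 0) := by
      rw [Finset.sum_range]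
      simp only [vecMul, dotProduct, hankel, Matrix.of_apply, Fintype.sum_prod_type, ha]
      refine Finset.sum_congr rfl fun i _ => ?_
      rw [Finset.mul_sum]
      simp_rw [add_mul, Finset.sum_add_distrib, Finset.sum_mul]
      rw [Finset.sum_comm]
      congr 1
      · refine Finset.sum_congr rfl fun k _ => ?_
        rw [add_comm (i : ℕ)]; ring
      · refine Finset.sum_congr rfl fun j _ => ?_
        split_ifs
        · rw [Finset.mul_sum]
          refine Finset.sum_congr rfl fun k _ => ?_
          rw [add_comm (i : ℕ)]; ring
        · simp
    have e2 : ∀ j ∈ Finset.range (nx + 1), η ⬝ᵥ (u (τ + j)).ofLp +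
        ∑ i ∈ Finset.range (nx + 1), (if i < j then r (j - 1 - i) ⬝ᵥ (u (τ + i)).ofLp else 0)
        = - (ξ ⬝ᵥ (A ^ j) *ᵥ x τ) := by
      intro j hj
      have hj' := Finset.mem_range.1 hj
      have h1 := h (τ + j) (by omega)
      rw [state_add_eq hx, dotProduct_add, dotProduct_sum] at h1
      rw [← Finset.sum_filter]
      have h2 : (Finset.range (nx + 1)).filter (· < j) = Finset.range j := by
        ext i; simp; omega
      rw [h2]
      have h3 : ∀ i, ξ ⬝ᵥ (A ^ (j - 1 - i) * B) *ᵥ (u (τ + i)).ofLp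
          = r (j - 1 - i) ⬝ᵥ (u (τ + i)).ofLp := fun i => Matrix.dotProduct_mulVec _ _ _
      simp_rw [h3] at h1
      linarith
    rw [e1, Finset.sum_add_distrib, Finset.sum_comm, ← Finset.sum_add_distrib]
    have e3 : ∀ j ∈ Finset.range (nx + 1), (p j * (η ⬝ᵥ (u (τ + j)).ofLp) +
        ∑ i ∈ Finset.range (nx + 1),
          if i < j then p j * (r (j - 1 - i) ⬝ᵥ (u (τ + i)).ofLp) else 0)
        = - (ξ ⬝ᵥ (p j • A ^ j) *ᵥ x τ) := by
      intro j hj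
      have := congrArg (p j * ·) (e2 j hj)
      simp only [mul_add, Finset.mul_sum, mul_ite, mul_zero] at this
      rw [this, Matrix.smul_mulVec, dotProduct_smul, smul_eq_mul, mul_neg]
    rw [Finset.sum_congr rfl e3, Finset.sum_neg_distrib, ← dotProduct_sum, ← Matrix.sum_mulVec,
      hCH]
    simp
  have ha0 : a = 0 := by
    refine eq_zero_of_vecMul_eq_zero_of_rank ?_ haH
    rw [hPE]; simp [mul_comm]
  have hη : η = 0 := by
    ext k
    have h1 := congrFun ha0 (Fin.last nx, k)
    simp only [ha, Fin.val_last, hpn, Pi.zero_apply, one_mul] at h1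
    rw [Finset.sum_eq_zero, add_zero] at h1
    · exact h1
    · intro j hj
      have := Finset.mem_range.1 hj
      rw [if_neg (by omega)]
  have hrk : ∀ k, k < nx → r k = 0 := by
    intro k
    induction k using Nat.strong_induction_on with
    | _ k ih =>
      intro hk
      ext c
      have h1 := congrFun ha0 (⟨nx - 1 - k, by omega⟩, c)
      simp only [ha, hη, Pi.zero_apply, mul_zero, zero_add] at h1
      rw [Finset.sum_eq_single nx] at h1
      · rw [if_pos (by omega), hpn, one_mul] at h1
        have : nx - 1 - (nx - 1 - k) = k := by omega
        rwa [this] at h1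
      · intro j hj hjn
        have := Finset.mem_range.1 hj
        split_ifs with hlt
        · rw [ih (j - 1 - (nx - 1 - k)) (by omega) (by omega)]; simp
        · rfl
      · simp
  exact ⟨hAB.eq_zero_of_vecMul hrk, hη⟩

end Fundamental

/-! ### Lyapunov certificates for controllable and observable pairs -/

section Lyapunov

variable {nx nu ny : ℕ} {A : Matrix (Fin nx) (Fin nx) ℝ} {B : Matrix (Fin nx) (Fin nu) ℝ}
  {C : Matrix (Fin ny) (Fin nx) ℝ}

/-- A controllable system is steered to the origin in `nx` steps by inputs that depend linearly on
the initial state; `X k` maps the initial state to the state after `k` steps. -/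
lemma Controllable.exists_deadbeat (h : Controllable A B) :
    ∃ (X : ℕ → Matrix (Fin nx) (Fin nx) ℝ) (U : ℕ → Matrix (Fin nu) (Fin nx) ℝ),
      X 0 = 1 ∧ (∀ k, X (k + 1) = A * X k + B * U k) ∧ X (nx + 1) = 0 := by
  obtain ⟨N, hN⟩ := exists_right_inverse_of_rank (M := Matrix.of fun (i : Fin nx)
    (k : Fin nx × Fin nu) => (A ^ (k.1 : ℕ) * B) i k.2) (by simpa [Controllable] using h)
  set V := N * (-A ^ nx) with hV
  set U : ℕ → Matrix (Fin nu) (Fin nx) ℝ := fun i =>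
    if hi : i < nx then Matrix.of fun k j => V (⟨nx - 1 - i, by omega⟩, k) j else 0 with hU
  let X : ℕ → Matrix (Fin nx) (Fin nx) ℝ := fun k =>
    Nat.rec 1 (fun k Xk => A * Xk + B * U k) k
  have hX0 : X 0 = 1 := rfl
  have hXs : ∀ k, X (k + 1) = A * X k + B * U k := fun k => rfl
  have hsum : ∑ i ∈ Finset.range nx, A ^ (nx - 1 - i) * B * U i = -A ^ nx := by
    have h1 : -A ^ nx = (Matrix.of fun (i : Fin nx) (k : Fin nx × Fin nu) =>
        (A ^ (k.1 : ℕ) * B) i k.2) * V := by rw [hV, ← Matrix.mul_assoc, hN, Matrix.one_mul]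
    rw [h1, ← Finset.sum_range_reflect]
    ext i j
    rw [Matrix.sum_apply, Finset.sum_range, Matrix.mul_apply, Fintype.sum_prod_type]
    refine Finset.sum_congr rfl fun k _ => ?_
    have hk : nx - 1 - (nx - 1 - (k : ℕ)) = k := by omega
    have hk' : nx - 1 - (k : ℕ) < nx := by omega
    rw [Matrix.mul_apply]
    simp [hU, hk, hk']
  have hXn : X nx = 0 := by
    have h1 : ∀ v, X nx *ᵥ v = 0 := by
      intro v
      have := state_add_eq (A := A) (B := B) (x := fun t => X t *ᵥ v) (u := fun t => U t *ᵥ v)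
        (fun t => by simp only [hXs, Matrix.add_mulVec, Matrix.mulVec_mulVec]) 0 nx
      simp only [zero_add, hX0, Matrix.one_mulVec, Matrix.mulVec_mulVec] at this
      rw [this, ← Matrix.sum_mulVec, hsum, ← Matrix.add_mulVec]
      simp
    ext i j
    have := congrFun (h1 (Pi.single j 1)) i
    simpa using this
  refine ⟨X, U, hX0, hXs, ?_⟩
  rw [hXs, hXn]
  simp [hU]

/-- Controllable pairs are stabilisable. If `X k` are the deadbeat state maps and
`P = ∑ X k (X k)ᵀ`, then the feedback obtained by regressing the inputs on the states satisfies
`F P = ∑ X (k + 1) (X k)ᵀ`, and `P - 1 - F P Fᵀ` is the sum of the squares of the residuals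
`X (k + 1) - F X k`. -/
lemma Controllable.exists_lyapunov (h : Controllable A B) :
    ∃ (P : Matrix (Fin nx) (Fin nx) ℝ) (K : Matrix (Fin nu) (Fin nx) ℝ), (P - 1).PosSemidef ∧
      (P - 1 - (A + B * K) * P * (A + B * K)ᵀ).PosSemidef := by
  obtain ⟨X, U, hX0, hXs, hXn⟩ := h.exists_deadbeat
  set P := ∑ k ∈ Finset.range (nx + 1), X k * (X k)ᵀ with hP
  set Z := ∑ k ∈ Finset.range (nx + 1), U k * (X k)ᵀ with hZ
  set N := ∑ k ∈ Finset.range (nx + 1), X (k + 1) * (X k)ᵀ with hN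
  have hP1 : P - 1 = ∑ k ∈ Finset.range nx, X (k + 1) * (X (k + 1))ᵀ := by
    rw [hP, Finset.sum_range_succ', hX0]; simp
  have hPge : (P - 1).PosSemidef := by
    rw [hP1]
    exact posSemidef_sum _ fun k _ => posSemidef_self_mul_transpose _
  have hPs : Pᵀ = P := (posDef_of_sub_one hPge).posSemidef.isHermitian
  set F := A + B * (Z * P⁻¹) with hF
  have hFP : F * P = N := by
    rw [hF, Matrix.add_mul, Matrix.mul_assoc, Matrix.mul_assoc,
      Matrix.nonsing_inv_mul P (isUnit_det_of_sub_one hPge), Matrix.mul_one, hN, hP, hZ,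
      Matrix.mul_sum, Matrix.mul_sum, ← Finset.sum_add_distrib]
    refine Finset.sum_congr rfl fun k _ => ?_
    rw [hXs, Matrix.add_mul, Matrix.mul_assoc, Matrix.mul_assoc]
  refine ⟨P, Z * P⁻¹, hPge, ?_⟩
  have key : P - 1 - F * P * Fᵀ = ∑ k ∈ Finset.range (nx + 1),
      (X (k + 1) - F * X k) * (X (k + 1) - F * X k)ᵀ := by
    have e1 : ∀ k, (X (k + 1) - F * X k) * (X (k + 1) - F * X k)ᵀ
        = X (k + 1) * (X (k + 1))ᵀ - X (k + 1) * (X k)ᵀ * Fᵀ - F * (X (k + 1) * (X k)ᵀ)ᵀ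
          + F * (X k * (X k)ᵀ) * Fᵀ := by
      intro k
      simp only [Matrix.transpose_sub, Matrix.transpose_mul, Matrix.sub_mul, Matrix.mul_sub,
        Matrix.mul_assoc, Matrix.transpose_transpose]
      abel
    simp_rw [e1]
    rw [Finset.sum_add_distrib, Finset.sum_sub_distrib, Finset.sum_sub_distrib, ← Matrix.sum_mul,
      ← Matrix.sum_mul, ← Matrix.mul_sum, ← Matrix.mul_sum, ← Matrix.transpose_sum, ← hN, ← hP,
      Finset.sum_range_succ, hXn, ← hP1, ← hFP, Matrix.transpose_mul, hPs]
    simp only [Matrix.mul_assoc, Matrix.zero_mul]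
    abel
  rw [key]
  exact posSemidef_sum _ fun k _ => posSemidef_self_mul_transpose _

lemma Observable.controllable_transpose (h : Observable A C) : Controllable Aᵀ Cᵀ := by
  unfold Observable at h
  unfold Controllable
  rw [← rank_transpose]
  refine Eq.trans (congrArg Matrix.rank ?_) h
  ext k i
  simp only [Matrix.transpose_apply, Matrix.of_apply]
  rw [← Matrix.transpose_pow, ← Matrix.transpose_mul, Matrix.transpose_apply]

lemma Observable.exists_lyapunov (h : Observable A C) :
    ∃ (S : Matrix (Fin nx) (Fin nx) ℝ) (L : Matrix (Fin nx) (Fin ny) ℝ), (S - 1).PosSemidef ∧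
      (S - 1 - (A - L * C)ᵀ * S * (A - L * C)).PosSemidef := by
  obtain ⟨S, K, hS, hK⟩ := h.controllable_transpose.exists_lyapunov
  refine ⟨S, -Kᵀ, hS, ?_⟩
  simpa [Matrix.transpose_mul, sub_eq_add_neg] using hK

/-- After doubling, a Lyapunov certificate has enough slack to survive a small perturbation. -/
lemma exists_lyapunov_margin {n : Type*} [Fintype n] [DecidableEq n] {F P : Matrix n n ℝ}
    (hP : (P - 1).PosSemidef) (h : (P - 1 - F * P * Fᵀ).PosSemidef) :
    ∃ η : ℝ, 0 < η ∧ ∀ F' : Matrix n n ℝ, ‖F' - F‖ ≤ η →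
      (-(F' * ((2 : ℝ) • P) * F'ᵀ - (2 : ℝ) • P + 1)).PosSemidef := by
  have hPs : Pᵀ = P := (posDef_of_sub_one hP).posSemidef.isHermitian
  set g : Matrix n n ℝ → Matrix n n ℝ := fun F' => (2 : ℝ) • (F' * P * F'ᵀ) - (2 : ℝ) • (F * P * Fᵀ)
    with hg
  have hgc : Continuous g := by fun_prop
  have hg0 : g F = 0 := by simp [hg]
  have hev : ∀ᶠ F' in 𝓝 F, ‖g F'‖ < 1 := by
    have : Tendsto (fun F' => ‖g F'‖) (𝓝 F) (𝓝 0) := by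
      have := hgc.norm.tendsto F
      simpa [hg0] using this
    exact this.eventually_lt_const one_pos
  obtain ⟨η, hη, hball⟩ := Metric.eventually_nhds_iff_ball.1 hev
  refine ⟨η / 2, by positivity, fun F' hF' => ?_⟩
  have h1 : ‖g F'‖ ≤ 1 := (hball F' (by rw [Metric.mem_ball, dist_eq_norm]; linarith)).le
  have hgs : (g F')ᵀ = g F' := by
    simp [hg, Matrix.transpose_mul, hPs, Matrix.mul_assoc]
  have h2 := posSemidef_smul_one_sub hgs h1
  have h3 := (h.smul (zero_le_two (α := ℝ))).add h2
  convert h3 using 1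
  have e : F' * ((2 : ℝ) • P) * F'ᵀ = (2 : ℝ) • (F' * P * F'ᵀ) := by
    rw [mul_smul_comm, smul_mul_assoc]
  simp only [hg]
  rw [e]
  module

end Lyapunov

/-! ### Closedness of the constraints and existence of minimisers -/

section Closed

variable {n : Type*} [Fintype n] [DecidableEq n]

lemma isClosed_posSemidef : IsClosed {M : Matrix n n ℝ | M.PosSemidef} := by
  simp_rw [posSemidef_real_iff, Set.ofPred_and, Set.ofPred_forall]
  refine (isClosed_eq (by fun_prop) (by fun_prop)).inter (isClosed_iInter fun x => ?_)
  exact isClosed_le continuous_const (by fun_prop)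

lemma continuousOn_inv_of_sub_one :
    ContinuousOn (fun P : Matrix n n ℝ => P⁻¹) {P | (P - 1).PosSemidef} := by
  simp_rw [Matrix.inv_def, Ring.inverse_eq_inv']
  have hd : Continuous fun P : Matrix n n ℝ => P.det := by fun_prop
  have ha : Continuous fun P : Matrix n n ℝ => P.adjugate := by fun_prop
  refine ContinuousOn.smul (ContinuousOn.inv₀ hd.continuousOn ?_) ha.continuousOn
  exact fun P hP => (isUnit_det_of_sub_one hP).ne_zero

lemma continuousOn_matrix_mul {V : Type*} [TopologicalSpace V] {S : Set V} {a b c : Type*}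
    [Fintype b] {p : V → Matrix a b ℝ} {q : V → Matrix b c ℝ} (hp : ContinuousOn p S)
    (hq : ContinuousOn q S) : ContinuousOn (fun z => p z * q z) S := by
  rw [continuousOn_iff_continuous_domRestrict] at hp hq ⊢
  exact hp.matrix_mul hq

lemma exists_min_of_bounded_sublevel {V : Type*} [NormedAddCommGroup V] [ProperSpace V] {S : Set V}
    (hS : IsClosed S) {f : V → ℝ} (hf : Continuous f) {z : V} (hz : z ∈ S) {r : ℝ}
    (hr : ∀ y ∈ S, f y ≤ f z → ‖y‖ ≤ r) : ∃ y ∈ S, ∀ y' ∈ S, f y ≤ f y' := by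
  have hcl : IsClosed (S ∩ {y | f y ≤ f z}) := hS.inter (isClosed_le hf continuous_const)
  have hco : IsCompact (S ∩ {y | f y ≤ f z}) := by
    refine Metric.isCompact_of_isClosed_isBounded hcl ?_
    exact (Metric.isBounded_closedBall (x := (0 : V)) (r := r)).subset
      fun y hy => by simpa using hr y hy.1 hy.2
  obtain ⟨y, hy, hmin⟩ := hco.exists_isMinOn ⟨z, hz, le_refl (f z)⟩ hf.continuousOn
  refine ⟨y, hy.1, fun y' hy' => ?_⟩
  rcases le_total (f y') (f z) with h | h
  · exact hmin ⟨hy', h⟩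
  · exact hy.2.trans h

end Closed

section Programs

variable {T nx nu ny : ℕ} {D : Data T nx nu ny}

/-! ### The state-feedback program -/

section LQR

variable {Wx : Matrix (Fin nx) (Fin nx) ℝ} {Wu : Matrix (Fin nu) (Fin nu) ℝ} {α₁ : ℝ}
  {s : LQRVar T nx nu}

/-- The quadratic terms of the state-feedback program in the parametrisation `S = Q P⁻¹`. -/
lemma mul_inv_mul_eq {m : Type*} {n : Type*} [Fintype n] [DecidableEq n]
    {P : Matrix n n ℝ} (hP : (P - 1).PosSemidef) (Q : Matrix m n ℝ) :
    Q * P⁻¹ * Qᵀ = (Q * P⁻¹) * P * (Q * P⁻¹)ᵀ := by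
  have hPi : (P⁻¹)ᵀ = P⁻¹ := (posDef_of_sub_one hP).inv.posSemidef.isHermitian
  rw [Matrix.mul_assoc Q P⁻¹ P, Matrix.nonsing_inv_mul P (isUnit_det_of_sub_one hP),
    Matrix.mul_one, Matrix.transpose_mul, hPi, Matrix.mul_assoc]

lemma mul_inv_mul_transpose_posSemidef {m : Type*} {n : Type*} [Fintype m] [DecidableEq m]
    [Fintype n] [DecidableEq n] {P : Matrix n n ℝ} (hP : (P - 1).PosSemidef) (Q : Matrix m n ℝ) :
    (Q * P⁻¹ * Qᵀ).PosSemidef :=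
  PosSemidef.conj_mul (posDef_of_sub_one hP).inv.posSemidef Q

lemma LQRFeasible.cost_terms (hs : LQRFeasible D Wx Wu α₁ s) (hWx : Wx.PosDef) (hWu : Wu.PosDef)
    (hα₁ : 0 < α₁) : (Wx * s.P).trace ≤ s.γ ∧ (Wu * s.G).trace ≤ s.γ ∧ α₁ * s.M₁.trace ≤ s.γ ∧
      s.P.PosSemidef ∧ s.G.PosSemidef ∧ s.M₁.PosSemidef := by
  have hP := (posDef_of_sub_one hs.P_ge).posSemidef
  have hG : s.G.PosSemidef := by
    have h := mul_inv_mul_transpose_posSemidef hs.P_ge (D.U0 * s.Q)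
    have := hs.G_ge.add h
    rw [Matrix.transpose_mul, ← Matrix.mul_assoc] at this
    simpa using this
  have hM : s.M₁.PosSemidef := by
    simpa using hs.M₁_ge.add (mul_inv_mul_transpose_posSemidef hs.P_ge s.Q)
  have h1 := PosSemidef.trace_mul_nonneg hWx.posSemidef hP
  have h2 := PosSemidef.trace_mul_nonneg hWu.posSemidef hG
  have h3 : 0 ≤ α₁ * s.M₁.trace := mul_nonneg hα₁.le hM.trace_nonneg
  have := hs.cost
  exact ⟨by linarith, by linarith, by linarith, hP, hG, hM⟩

/-- The regulariser `tr M₁` bounds the gain parametrisation `Q P⁻¹`. -/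
lemma LQRFeasible.norm_sq_le (hs : LQRFeasible D Wx Wu α₁ s) (hWx : Wx.PosDef) (hWu : Wu.PosDef)
    (hα₁ : 0 < α₁) : ‖s.Q * s.P⁻¹‖ ^ 2 ≤ s.γ / α₁ := by
  have h1 := PosSemidef.conj_mul hs.P_ge (s.Q * s.P⁻¹)
  rw [Matrix.mul_sub, Matrix.sub_mul, Matrix.mul_one, ← mul_inv_mul_eq hs.P_ge] at h1
  have h2 := trace_le_trace_of_sub (PosSemidef.sub_trans hs.M₁_ge h1)
  have h3 := norm_sq_le_trace_mul_transpose (s.Q * s.P⁻¹)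
  have h4 := (hs.cost_terms hWx hWu hα₁).2.2.1
  rw [le_div_iff₀ hα₁]
  nlinarith

/-- Attainment of the optimum: on `P ⪰ 1` the constraints are closed, and a bound on the cost bounds
`P` and `G` through the positive definite weights, `M₁` through its trace, and `Q = S P` through
`‖S‖² ≤ tr M₁`. -/
lemma LQRFeasible.exists_isOptimal (hs : LQRFeasible D Wx Wu α₁ s) (hWx : Wx.PosDef)
    (hWu : Wu.PosDef) (hα₁ : 0 < α₁) :
    ∃ s', IsOptimal (LQRFeasible D Wx Wu α₁) LQRVar.γ s' := by
  let V := Matrix (Fin T) (Fin nx) ℝ × Matrix (Fin nx) (Fin nx) ℝ × Matrix (Fin nu) (Fin nu) ℝ ×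
    Matrix (Fin T) (Fin T) ℝ
  let f : V → ℝ := fun z => (Wx * z.2.1).trace + (Wu * z.2.2.1).trace + α₁ * z.2.2.2.trace
  let mk : V → LQRVar T nx nu := fun z => ⟨f z, z.1, z.2.1, z.2.2.1, z.2.2.2⟩
  let S : Set V := {z | LQRFeasible D Wx Wu α₁ (mk z)}
  have hf : Continuous f := by fun_prop
  have hS : IsClosed S := by
    let c1 : Set V := {z | (z.2.1 - 1).PosSemidef}
    have hc1 : IsClosed c1 := isClosed_posSemidef.preimage (by fun_prop)
    have hinv : ContinuousOn (fun z : V => (z.2.1)⁻¹) c1 :=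
      continuousOn_inv_of_sub_one.comp (by fun_prop) fun z hz => hz
    let g : V → Matrix (Fin nx) (Fin nx) ℝ × Matrix (Fin nu) (Fin nu) ℝ ×
        Matrix (Fin T) (Fin T) ℝ × Matrix (Fin nx) (Fin nx) ℝ := fun z =>
      (-(D.X1 * z.1 * z.2.1⁻¹ * z.1ᵀ * D.X1ᵀ - z.2.1 + 1),
        z.2.2.1 - D.U0 * z.1 * z.2.1⁻¹ * z.1ᵀ * D.U0ᵀ,
        z.2.2.2 - z.1 * z.2.1⁻¹ * z.1ᵀ, D.X0 * z.1 - z.2.1)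
    have hg : ContinuousOn g c1 := by
      have hQ : ContinuousOn (fun z : V => z.1) c1 := continuous_fst.continuousOn
      have hQt : ContinuousOn (fun z : V => z.1ᵀ) c1 :=
        continuous_fst.matrix_transpose.continuousOn
      have hmid := continuousOn_matrix_mul (continuousOn_matrix_mul hQ hinv) hQt
      refine ContinuousOn.prodMk ?_ (ContinuousOn.prodMk ?_ (ContinuousOn.prodMk ?_ ?_))
      · exact ((continuousOn_matrix_mul (continuousOn_matrix_mul (continuousOn_matrix_mul (continuousOn_matrix_mul continuousOn_const hQ) hinv) hQt) continuousOn_const).sub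
          (by fun_prop)).add continuousOn_const |>.neg
      · exact ContinuousOn.sub (by fun_prop)
          (continuousOn_matrix_mul (continuousOn_matrix_mul (continuousOn_matrix_mul (continuousOn_matrix_mul continuousOn_const hQ) hinv) hQt) continuousOn_const)
      · exact ContinuousOn.sub (by fun_prop) hmid
      · exact (continuousOn_matrix_mul continuousOn_const hQ).sub (by fun_prop)
    have := hg.preimage_isClosed_of_isClosed hc1
      (isClosed_posSemidef.prod (isClosed_posSemidef.prod (isClosed_posSemidef.prod
        (isClosed_singleton (x := (0 : Matrix (Fin nx) (Fin nx) ℝ))))))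
    convert this using 1
    ext z
    constructor
    · intro h
      exact ⟨h.P_ge, h.lyap, h.G_ge, h.M₁_ge, sub_eq_zero.2 h.X0_Q⟩
    · rintro ⟨h1, h2, h3, h4, h5⟩
      exact ⟨h2, h1, h3, h4, sub_eq_zero.1 h5, le_rfl⟩
  have hz : ∀ s, LQRFeasible D Wx Wu α₁ s → ((s.Q, s.P, s.G, s.M₁) : V) ∈ S :=
    fun s h => ⟨h.lyap, h.P_ge, h.G_ge, h.M₁_ge, h.X0_Q, le_rfl⟩
  obtain ⟨cx, hcx0, hcx⟩ := PosDef.exists_trace_le hWx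
  obtain ⟨cu, hcu0, hcu⟩ := PosDef.exists_trace_le hWu
  set c := f (s.Q, s.P, s.G, s.M₁) with hc
  obtain ⟨y, hy, hmin⟩ := exists_min_of_bounded_sublevel hS hf (hz s hs)
    (r := max (√(c / α₁) * (cx * c)) (max (cx * c) (max (cu * c) (c / α₁)))) (by
      intro y hy hyc
      have hF : LQRFeasible D Wx Wu α₁ (mk y) := hy
      obtain ⟨h1, h2, h3, hP, hG, hM⟩ := hF.cost_terms hWx hWu hα₁
      have h4 := hF.norm_sq_le hWx hWu hα₁
      have e : f y ≤ c := hyc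
      change (Wx * y.2.1).trace ≤ f y at h1
      change (Wu * y.2.2.1).trace ≤ f y at h2
      change α₁ * y.2.2.2.trace ≤ f y at h3
      change ‖y.1 * y.2.1⁻¹‖ ^ 2 ≤ f y / α₁ at h4
      change y.2.1.PosSemidef at hP
      change y.2.2.1.PosSemidef at hG
      change y.2.2.2.PosSemidef at hM
      have nP : ‖y.2.1‖ ≤ cx * c :=
        (PosSemidef.norm_le_trace hP).trans ((hcx _ hP).trans (by gcongr; linarith))
      have nG : ‖y.2.2.1‖ ≤ cu * c :=
        (PosSemidef.norm_le_trace hG).trans ((hcu _ hG).trans (by gcongr; linarith))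
      have nM : ‖y.2.2.2‖ ≤ c / α₁ :=
        (PosSemidef.norm_le_trace hM).trans (by rw [le_div_iff₀ hα₁]; linarith)
      have nS : ‖y.1 * y.2.1⁻¹‖ ≤ √(c / α₁) :=
        Real.le_sqrt_of_sq_le (h4.trans (by gcongr))
      have nQ : ‖y.1‖ ≤ √(c / α₁) * (cx * c) := by
        have e1 : y.1 = y.1 * y.2.1⁻¹ * y.2.1 := by
          rw [Matrix.mul_assoc, Matrix.nonsing_inv_mul _ (isUnit_det_of_sub_one hF.P_ge),
            Matrix.mul_one]
        calc ‖y.1‖ = ‖y.1 * y.2.1⁻¹ * y.2.1‖ := by rw [← e1]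
          _ ≤ ‖y.1 * y.2.1⁻¹‖ * ‖y.2.1‖ := l2_opNorm_mul _ _
          _ ≤ _ := by gcongr
      exact max_le_max nQ (max_le_max nP (max_le_max nG nM)))
  refine ⟨mk y, hy, fun s' hs' => ?_⟩
  exact (hmin _ (hz s' hs')).trans hs'.cost

end LQR

/-! ### The right-inverse program -/

section Phi

variable {p : PhiVar T nx nu}

lemma PhiFeasible.sub_posSemidef (hp : PhiFeasible D p) :
    (p.M₂ - p.Φ₁ᵀ * p.Φ₁).PosSemidef := by
  have h := hp.block
  let _ : Invertible (1 : Matrix (Fin T) (Fin T) ℝ) := invertibleOne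
  have := (PosDef.fromBlocks₂₂ p.M₂ p.Φ₁ᵀ (PosDef.one (n := Fin T) (R := ℝ))).1 (by simpa using h)
  simpa using this

lemma PhiFeasible.of_rightInv {Φ₁ : Matrix (Fin T) (Fin nx) ℝ} {Φ₂ : Matrix (Fin T) (Fin nu) ℝ}
    (h : D.Phi0 * fromCols Φ₁ Φ₂ = 1) :
    PhiFeasible D ⟨(Φ₁ᵀ * Φ₁).trace, Φ₁ᵀ * Φ₁, Φ₁, Φ₂⟩ := by
  refine ⟨h, ?_, le_rfl⟩
  let _ : Invertible (1 : Matrix (Fin T) (Fin T) ℝ) := invertibleOne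
  have := (PosDef.fromBlocks₂₂ (Φ₁ᵀ * Φ₁) Φ₁ᵀ (PosDef.one (n := Fin T) (R := ℝ))).2
    (by simpa using PosSemidef.zero)
  simpa using this

lemma PhiFeasible.norm_sq_le (hp : PhiFeasible D p) : ‖p.Φ₁‖ ^ 2 ≤ p.ρ := by
  have h1 := trace_le_trace_of_sub hp.sub_posSemidef
  have h2 := norm_sq_le_trace_mul_transpose p.Φ₁ᵀ
  rw [transpose_transpose, norm_transpose] at h2
  linarith [hp.cost]

lemma Phi0_mul_fromCols_eq_one_iff {Φ₁ : Matrix (Fin T) (Fin nx) ℝ}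
    {Φ₂ : Matrix (Fin T) (Fin nu) ℝ} : D.Phi0 * fromCols Φ₁ Φ₂ = 1 ↔
      D.X0 * Φ₁ = 1 ∧ D.X0 * Φ₂ = 0 ∧ D.U0 * Φ₁ = 0 ∧ D.U0 * Φ₂ = 1 := by
  rw [Data.Phi0, fromRows_mul_fromCols, ← fromBlocks_one, fromBlocks_inj]

/-- Among the right inverses of `Φ₀`, a minimiser of `tr (Φ₁ᵀ Φ₁)` exists; the second block is
free, so that it can be taken from any prescribed right inverse. -/
lemma PhiFeasible.exists_isOptimal {Φ₁ : Matrix (Fin T) (Fin nx) ℝ}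
    {Φ₂ : Matrix (Fin T) (Fin nu) ℝ} (h : D.Phi0 * fromCols Φ₁ Φ₂ = 1) :
    ∃ p, IsOptimal (PhiFeasible D) PhiVar.ρ p ∧ p.Φ₂ = Φ₂ := by
  obtain ⟨h1, h2, h3, h4⟩ := Phi0_mul_fromCols_eq_one_iff.1 h
  let S : Set (Matrix (Fin T) (Fin nx) ℝ) := {Ψ | D.X0 * Ψ = 1 ∧ D.U0 * Ψ = 0}
  have hS : IsClosed S :=
    (isClosed_eq (by fun_prop) continuous_const).inter (isClosed_eq (by fun_prop) continuous_const)
  let f : Matrix (Fin T) (Fin nx) ℝ → ℝ := fun Ψ => (Ψᵀ * Ψ).trace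
  obtain ⟨Ψ, hΨ, hmin⟩ := exists_min_of_bounded_sublevel hS (f := f) (by fun_prop) (z := Φ₁)
    ⟨h1, h3⟩ (r := √(f Φ₁)) (by
      intro y _ hy
      refine Real.le_sqrt_of_sq_le (le_trans ?_ hy)
      simpa [norm_transpose] using norm_sq_le_trace_mul_transpose yᵀ)
  refine ⟨_, ⟨PhiFeasible.of_rightInv (Φ₁ := Ψ) (Φ₂ := Φ₂)
    (Phi0_mul_fromCols_eq_one_iff.2 ⟨hΨ.1, h2, hΨ.2, h4⟩), fun p hp => ?_⟩, rfl⟩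
  obtain ⟨g1, -, g3, -⟩ := Phi0_mul_fromCols_eq_one_iff.1 hp.rightInv
  exact (hmin p.Φ₁ ⟨g1, g3⟩).trans ((trace_le_trace_of_sub hp.sub_posSemidef).trans hp.cost)

end Phi

/-! ### The observer program -/

section LQG

variable {Φ₁ : Matrix (Fin T) (Fin nx) ℝ} {Nx : Matrix (Fin nx) (Fin nx) ℝ}
  {Ny : Matrix (Fin ny) (Fin ny) ℝ} {α₂ : ℝ} {q : LQGVar nx ny}

lemma LQGFeasible.norm_le (hq : LQGFeasible D Φ₁ Nx Ny α₂ q) (hNx : Nx.PosSemidef)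
    (hNy : Ny.PosSemidef) (hα₂ : 0 < α₂) :
    ‖q.Ups‖ ≤ q.ε / α₂ ∧ ‖q.Sig‖ ≤ q.ε / α₂ ∧ ‖q.Pi‖ ≤ q.ε / α₂ := by
  have hS := (posDef_of_sub_one hq.Sig_ge).posSemidef
  have hU : q.Ups.PosSemidef := by
    have h := mul_inv_mul_transpose_posSemidef hq.Sig_ge q.Piᵀ
    rw [transpose_transpose] at h
    simpa using hq.Ups_ge.add h
  have h1 := PosSemidef.trace_mul_nonneg hNx hS
  have h2 := PosSemidef.trace_mul_nonneg hNy hU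
  have h3 := hq.cost
  simp only [specNorm_eq_norm] at h3
  have hsum : ‖q.Ups‖ + ‖q.Sig‖ + ‖q.Pi‖ ≤ q.ε / α₂ := by
    rw [le_div_iff₀ hα₂]; linarith
  have n1 := norm_nonneg q.Ups
  have n2 := norm_nonneg q.Sig
  have n3 := norm_nonneg q.Pi
  exact ⟨by linarith, by linarith, by linarith⟩

/-- Attainment of the optimum: the norm penalty makes the cost coercive on the closed feasible
set. -/
lemma LQGFeasible.exists_isOptimal (hq : LQGFeasible D Φ₁ Nx Ny α₂ q) (hNx : Nx.PosSemidef)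
    (hNy : Ny.PosSemidef) (hα₂ : 0 < α₂) :
    ∃ q', IsOptimal (LQGFeasible D Φ₁ Nx Ny α₂) LQGVar.ε q' := by
  let V := Matrix (Fin nx) (Fin ny) ℝ × Matrix (Fin nx) (Fin nx) ℝ × Matrix (Fin ny) (Fin ny) ℝ
  let f : V → ℝ := fun z => (Nx * z.2.1).trace + (Ny * z.2.2).trace
    + α₂ * (‖z.2.2‖ + ‖z.2.1‖ + ‖z.1‖)
  let mk : V → LQGVar nx ny := fun z => ⟨f z, z.1, z.2.1, z.2.2⟩
  let S : Set V := {z | LQGFeasible D Φ₁ Nx Ny α₂ (mk z)}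
  have hf : Continuous f := by fun_prop
  have hS : IsClosed S := by
    let c1 : Set V := {z | (z.2.1 - 1).PosSemidef}
    have hc1 : IsClosed c1 := isClosed_posSemidef.preimage (by fun_prop)
    have hinv : ContinuousOn (fun z : V => (z.2.1)⁻¹) c1 :=
      continuousOn_inv_of_sub_one.comp (by fun_prop) fun z hz => hz
    let g : V → Matrix (Fin nx) (Fin nx) ℝ × Matrix (Fin ny) (Fin ny) ℝ := fun z =>
      (-(Φ₁ᵀ * (z.2.1 * D.X1 - z.1 * D.Y0)ᵀ * z.2.1⁻¹ * (z.2.1 * D.X1 - z.1 * D.Y0) * Φ₁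
          - z.2.1 + 1), z.2.2 - z.1ᵀ * z.2.1⁻¹ * z.1)
    have hg : ContinuousOn g c1 := by
      have hE : Continuous (fun z : V => z.2.1 * D.X1 - z.1 * D.Y0) :=
        (continuous_snd.fst.matrix_mul continuous_const).sub
          (continuous_fst.matrix_mul continuous_const)
      refine ContinuousOn.prodMk ?_ ?_
      · exact ((continuousOn_matrix_mul (continuousOn_matrix_mul (continuousOn_matrix_mul (continuousOn_matrix_mul continuousOn_const
          hE.matrix_transpose.continuousOn) hinv) hE.continuousOn) continuousOn_const).sub
          (by fun_prop)).add continuousOn_const |>.neg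
      · exact ContinuousOn.sub (by fun_prop) (continuousOn_matrix_mul (continuousOn_matrix_mul
          continuous_fst.matrix_transpose.continuousOn hinv) continuous_fst.continuousOn)
    have := hg.preimage_isClosed_of_isClosed hc1 (isClosed_posSemidef.prod isClosed_posSemidef)
    convert this using 1
    ext z
    constructor
    · intro h
      exact ⟨h.Sig_ge, h.lyap, h.Ups_ge⟩
    · rintro ⟨h1, h2, h3⟩
      exact ⟨h2, h1, h3, le_rfl⟩
  have hz : ∀ q, LQGFeasible D Φ₁ Nx Ny α₂ q → ((q.Pi, q.Sig, q.Ups) : V) ∈ S :=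
    fun q h => ⟨h.lyap, h.Sig_ge, h.Ups_ge, le_rfl⟩
  set c := f (q.Pi, q.Sig, q.Ups) with hc
  obtain ⟨y, hy, hmin⟩ := exists_min_of_bounded_sublevel hS hf (hz q hq) (r := c / α₂) (by
      intro y hy hyc
      have hF : LQGFeasible D Φ₁ Nx Ny α₂ (mk y) := hy
      obtain ⟨h1, h2, h3⟩ := hF.norm_le hNx hNy hα₂
      have e : f y / α₂ ≤ c / α₂ := by gcongr
      exact max_le (h3.trans e) (max_le (h2.trans e) (h1.trans e)))
  refine ⟨mk y, hy, fun q' hq' => ?_⟩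
  exact (hmin _ (hz q' hq')).trans hq'.cost

end LQG

end Programs

/-! ### Contractive norms from Lyapunov certificates -/

section Act

variable {k m n : ℕ}

lemma act_eq (M : Matrix (Fin m) (Fin n) ℝ) (x : Vec n) :
    act M x = WithLp.toLp 2 (M *ᵥ x.ofLp) := rfl

lemma norm_act_le (M : Matrix (Fin m) (Fin n) ℝ) (x : Vec n) : ‖act M x‖ ≤ ‖M‖ * ‖x‖ :=
  norm_toLp_mulVec_le M x.ofLp

lemma act_add (M : Matrix (Fin m) (Fin n) ℝ) (x y : Vec n) :
    act M (x + y) = act M x + act M y := map_add _ _ _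

lemma act_sub (M : Matrix (Fin m) (Fin n) ℝ) (x y : Vec n) :
    act M (x - y) = act M x - act M y := map_sub _ _ _

lemma add_act (M N : Matrix (Fin m) (Fin n) ℝ) (x : Vec n) :
    act (M + N) x = act M x + act N x := by simp [act]

lemma sub_act (M N : Matrix (Fin m) (Fin n) ℝ) (x : Vec n) :
    act (M - N) x = act M x - act N x := by simp [act]

lemma neg_act (M : Matrix (Fin m) (Fin n) ℝ) (x : Vec n) : act (-M) x = -act M x := by
  simp [act]

lemma mul_act (M : Matrix (Fin k) (Fin m) ℝ) (N : Matrix (Fin m) (Fin n) ℝ) (x : Vec n) :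
    act (M * N) x = act M (act N x) := by
  simp [act_eq, Matrix.mulVec_mulVec]

lemma norm_sq_act_transpose (R : Matrix (Fin m) (Fin n) ℝ) (x : Vec m) :
    ‖act Rᵀ x‖ ^ 2 = x.ofLp ⬝ᵥ (R * Rᵀ) *ᵥ x.ofLp := by
  rw [act_eq, norm_sq_toLp, ← Matrix.mulVec_mulVec, Matrix.dotProduct_mulVec x.ofLp R,
    ← Matrix.mulVec_transpose]

end Act

section Contraction

variable {n : ℕ}

/-- `x ↦ ‖N x‖` is a norm, equivalent to the Euclidean one with constants `1` and `p`, that the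
matrix `F` contracts by the factor `√(1 - 1/p)`. -/
def Contracts (p : ℝ) (F N : Matrix (Fin n) (Fin n) ℝ) : Prop :=
  ∀ x : Vec n, ‖x‖ ≤ ‖act N x‖ ∧ ‖act N x‖ ≤ p * ‖x‖ ∧
    ‖act N (act F x)‖ ≤ √(1 - 1 / p) * ‖act N x‖

lemma exists_contracts_of_lyapunov {p : ℝ} (hp : 1 ≤ p) {E S : Matrix (Fin n) (Fin n) ℝ}
    (hS : (S - 1).PosSemidef) (hE : (S - 1 - Eᵀ * S * E).PosSemidef) (hSp : ‖S‖ ≤ p) :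
    ∃ N, Contracts p E N := by
  obtain ⟨R, hR⟩ := PosSemidef.exists_mul_transpose (posDef_of_sub_one hS).posSemidef
  have hp1 : 0 ≤ 1 - 1 / p := by
    rw [sub_nonneg, div_le_one (by linarith)]; exact hp
  refine ⟨Rᵀ, fun x => ?_⟩
  have hsq : ∀ y : Vec n, ‖act Rᵀ y‖ ^ 2 = y.ofLp ⬝ᵥ S *ᵥ y.ofLp := fun y => by
    rw [norm_sq_act_transpose, ← hR]
  have hxx : ‖x‖ ^ 2 = x.ofLp ⬝ᵥ x.ofLp := norm_sq_toLp x.ofLp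
  have h1 : ‖x‖ ^ 2 ≤ ‖act Rᵀ x‖ ^ 2 := by
    have := (posSemidef_real_iff.1 hS).2 x.ofLp
    rw [Matrix.sub_mulVec, Matrix.one_mulVec, dotProduct_sub, ← hsq, ← hxx] at this
    linarith
  have h2 : ‖act Rᵀ x‖ ^ 2 ≤ p * ‖x‖ ^ 2 := by
    have h3 : ‖Rᵀ‖ ^ 2 ≤ p := by
      rw [norm_transpose, ← norm_mul_transpose_self, ← hR]; exact hSp
    calc ‖act Rᵀ x‖ ^ 2 ≤ (‖Rᵀ‖ * ‖x‖) ^ 2 :=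
          pow_le_pow_left₀ (norm_nonneg _) (norm_act_le _ _) 2
      _ = ‖Rᵀ‖ ^ 2 * ‖x‖ ^ 2 := by ring
      _ ≤ _ := by gcongr
  have h3 : ‖act Rᵀ (act E x)‖ ^ 2 ≤ ‖act Rᵀ x‖ ^ 2 - ‖x‖ ^ 2 := by
    have := (posSemidef_real_iff.1 hE).2 x.ofLp
    rw [Matrix.sub_mulVec, Matrix.sub_mulVec, Matrix.one_mulVec, dotProduct_sub, dotProduct_sub,
      ← hsq, ← hxx, ← Matrix.mulVec_mulVec, ← Matrix.mulVec_mulVec,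
      Matrix.dotProduct_mulVec _ Eᵀ, Matrix.vecMul_transpose] at this
    have e : (E *ᵥ x.ofLp) ⬝ᵥ S *ᵥ (E *ᵥ x.ofLp) = ‖act Rᵀ (act E x)‖ ^ 2 := by
      rw [hsq]; rfl
    linarith
  refine ⟨abs_le_of_sq_le_sq' h1 (norm_nonneg _) |>.2,
    abs_le_of_sq_le_sq' ?_ (by positivity) |>.2, abs_le_of_sq_le_sq' ?_ (by positivity) |>.2⟩
  · nlinarith [sq_nonneg ‖x‖]
  · rw [mul_pow, Real.sq_sqrt hp1]
    have h4 : ‖act Rᵀ x‖ ^ 2 / p ≤ ‖x‖ ^ 2 := by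
      rw [div_le_iff₀ (by linarith)]; linarith
    have h5 : (1 - 1 / p) * ‖act Rᵀ x‖ ^ 2 = ‖act Rᵀ x‖ ^ 2 - ‖act Rᵀ x‖ ^ 2 / p := by ring
    linarith

/-- The dual form: a certificate `F P Fᵀ ⪯ P - 1` gives the norm `p ‖D⁻¹ x‖`, where
`P = D Dᵀ`. -/
lemma exists_contracts_of_dual_lyapunov {p : ℝ} (hp : 1 ≤ p) {F P : Matrix (Fin n) (Fin n) ℝ}
    (hP : (P - 1).PosSemidef) (hF : (P - 1 - F * P * Fᵀ).PosSemidef) (hPp : ‖P‖ ≤ p) :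
    ∃ N, Contracts p F N := by
  have hpd := posDef_of_sub_one hP
  obtain ⟨D, hD⟩ := PosSemidef.exists_mul_transpose hpd.posSemidef
  have hp0 : 0 < p := by linarith
  have hp1 : 0 ≤ 1 - 1 / p := by rw [sub_nonneg, div_le_one hp0]; exact hp
  have huD : IsUnit D.det := by
    have := isUnit_det_of_sub_one hP
    rw [hD, det_mul] at this
    exact isUnit_of_mul_isUnit_left this
  have hDi : D⁻¹ * D = 1 := Matrix.nonsing_inv_mul D huD
  have hDi' : D * D⁻¹ = 1 := Matrix.mul_nonsing_inv D huD
  have hDPD : D⁻¹ * P * (D⁻¹)ᵀ = 1 := by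
    rw [hD, ← Matrix.mul_assoc, hDi, Matrix.one_mul, ← Matrix.transpose_mul, hDi, transpose_one]
  -- in the coordinates `D⁻¹ x` the matrix `F` becomes `G`, of norm less than one
  set G := D⁻¹ * F * D with hG
  have hGG : G * Gᵀ = D⁻¹ * (F * P * Fᵀ) * (D⁻¹)ᵀ := by
    rw [hG, hD]
    simp only [Matrix.transpose_mul, Matrix.mul_assoc]
  have hGn : ‖G‖ ≤ √(1 - 1 / p) := by
    refine Real.le_sqrt_of_sq_le ?_
    rw [← norm_mul_transpose_self]
    refine PosSemidef.norm_le_of_sub (posSemidef_self_mul_transpose G) hp1 ?_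
    have h1 := PosSemidef.conj_mul hF D⁻¹
    have hPs : Pᵀ = P := hpd.posSemidef.isHermitian
    have h2 := PosSemidef.conj_mul (posSemidef_smul_one_sub hPs hPp) D⁻¹
    have h3 := h1.add (h2.smul (inv_nonneg.2 hp0.le))
    convert h3 using 1
    simp only [Matrix.mul_sub, Matrix.sub_mul, hDPD, ← hGG, mul_smul_comm, smul_mul_assoc,
      smul_sub, smul_smul, inv_mul_cancel₀ hp0.ne', one_smul, sub_smul, one_div]
    abel
  have hDn : ‖D‖ ≤ p := by
    have h1 : ‖D‖ ^ 2 ≤ p := by rw [← norm_mul_transpose_self, ← hD]; exact hPp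
    exact abs_le_of_sq_le_sq' (by nlinarith) hp0.le |>.2
  have hDin : ‖D⁻¹‖ ≤ 1 := by
    have h1 : ‖D⁻¹‖ ^ 2 ≤ 1 := by
      rw [← norm_transpose_mul_self, transpose_nonsing_inv, ← Matrix.mul_inv_rev, ← hD]
      exact norm_inv_le_one hP
    exact abs_le_of_sq_le_sq' (by simpa using h1) zero_le_one |>.2
  have hN : ∀ y : Vec n, ‖act (p • D⁻¹) y‖ = p * ‖act D⁻¹ y‖ := fun y => by
    have : act (p • D⁻¹) y = p • act D⁻¹ y := by simp [act]
    rw [this, norm_smul, Real.norm_of_nonneg hp0.le]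
  refine ⟨p • D⁻¹, fun x => ?_⟩
  simp only [hN]
  refine ⟨?_, ?_, ?_⟩
  · calc ‖x‖ = ‖act D (act D⁻¹ x)‖ := by rw [← mul_act, hDi']; simp [act]
      _ ≤ ‖D‖ * ‖act D⁻¹ x‖ := norm_act_le _ _
      _ ≤ p * ‖act D⁻¹ x‖ := by gcongr
  · gcongr
    calc ‖act D⁻¹ x‖ ≤ ‖D⁻¹‖ * ‖x‖ := norm_act_le _ _
      _ ≤ 1 * ‖x‖ := by gcongr
      _ = ‖x‖ := one_mul _
  · have e : act D⁻¹ (act F x) = act G (act D⁻¹ x) := by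
      rw [← mul_act, ← mul_act, hG, Matrix.mul_assoc _ D, hDi', Matrix.mul_one]
    rw [e]
    calc p * ‖act G (act D⁻¹ x)‖ ≤ p * (√(1 - 1 / p) * ‖act D⁻¹ x‖) := by
          gcongr; exact (norm_act_le _ _).trans (by gcongr)
      _ = _ := by ring

end Contraction

/-! ### Decay of a perturbed cascade -/

lemma geometric_bound {V : ℕ → ℝ} {μ d : ℝ} (hμ0 : 0 ≤ μ) (hμ1 : μ < 1) (hd : 0 ≤ d) {t : ℕ}
    (hV : ∀ s < t, V (s + 1) ≤ μ * V s + d) : V t ≤ μ ^ t * V 0 + d / (1 - μ) := by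
  have h1 : 0 < 1 - μ := by linarith
  induction t with
  | zero => simpa using div_nonneg hd h1.le
  | succ t ih =>
    have h2 := ih fun s hs => hV s (hs.trans t.lt_succ_self)
    calc V (t + 1) ≤ μ * V t + d := hV t t.lt_succ_self
      _ ≤ μ * (μ ^ t * V 0 + d / (1 - μ)) + d := by gcongr
      _ = μ ^ (t + 1) * V 0 + d / (1 - μ) := by field_simp; ring

/-- The cascade `e ↦ E e`, `z ↦ F z + H e` of two contractions stays exponentially stable under
coupling terms of norm at most `η`, where `η` and the rate depend only on the equivalence constant
`p` of the contracted norms and on a bound `h` of `‖H‖`. -/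
lemma exists_uniform_decay (p h : ℝ) (hp : 1 ≤ p) (hh : 0 ≤ h) :
    ∃ η μ c : ℝ, 0 < η ∧ 0 < μ ∧ μ < 1 ∧ 0 < c ∧
      ∀ {n : ℕ} {E F N₁ N₂ G₁ G₂ G₃ H : Matrix (Fin n) (Fin n) ℝ},
        Contracts p E N₁ → Contracts p F N₂ → ‖G₁‖ ≤ η → ‖G₂‖ ≤ η → ‖G₃‖ ≤ η → ‖H‖ ≤ h →
        ∀ e z d₁ d₂ : ℕ → Vec n,
          (∀ t, e (t + 1) = act E (e t) + act G₁ (e t) + act G₂ (z t) + d₁ t) →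
          (∀ t, z (t + 1) = act F (z t) + act G₃ (z t) + act H (e t) + d₂ t) → z 0 = 0 →
          ∀ t d, 0 ≤ d → (∀ s < t, ‖d₁ s‖ ≤ d ∧ ‖d₂ s‖ ≤ d) →
            ‖e t‖ + ‖z t‖ ≤ c * (μ ^ t * ‖e 0‖ + d) := by
  have hp0 : 0 < p := by linarith
  set lam := √(1 - 1 / p) with hlam
  have hl0 : 0 ≤ lam := Real.sqrt_nonneg _
  have hl1 : lam < 1 := by
    rw [hlam, Real.sqrt_lt' one_pos]
    have : 0 < 1 / p := by positivity
    linarith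
  have hl : 0 < 1 - lam := by linarith
  -- the error is weighted by `κ`, so that the coupling `H` costs half of the contraction
  set κ := 1 + 2 * p * h / (1 - lam) with hκ
  have hκ1 : 1 ≤ κ := by rw [hκ]; linarith [show 0 ≤ 2 * p * h / (1 - lam) by positivity]
  have hκh : p * h ≤ (1 - lam) / 2 * κ := by
    have : (1 - lam) / 2 * κ = (1 - lam) / 2 + p * h := by rw [hκ]; field_simp
    linarith
  set η := (1 - lam) / (4 * (1 + κ) * p) with hη
  have hηe : (1 + κ) * p * η = (1 - lam) / 4 := by
    have : 1 + κ ≠ 0 := by linarith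
    rw [hη]; field_simp
  have hη0 : 0 < η := by rw [hη]; positivity
  set μ := (3 + lam) / 4 with hμ
  have hμ1 : μ < 1 := by rw [hμ]; linarith
  have hμ0 : 0 < μ := by rw [hμ]; linarith
  refine ⟨η, μ, κ * p + (1 + κ) * p / (1 - μ), hη0, hμ0, hμ1,
    by have : 0 < 1 - μ := by linarith
       positivity, ?_⟩
  intro n E F N₁ N₂ G₁ G₂ G₃ H hE hF hG₁ hG₂ hG₃ hH e z d₁ d₂ he hz hz0 t d hd hdt
  set a : ℕ → ℝ := fun t => ‖act N₁ (e t)‖ with ha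
  set b : ℕ → ℝ := fun t => ‖act N₂ (z t)‖ with hb
  have ha0 : ∀ t, 0 ≤ a t := fun t => norm_nonneg _
  have hb0 : ∀ t, 0 ≤ b t := fun t => norm_nonneg _
  have hea : ∀ t, ‖e t‖ ≤ a t := fun t => (hE _).1
  have hzb : ∀ t, ‖z t‖ ≤ b t := fun t => (hF _).1
  have hstep_a : ∀ s < t, a (s + 1) ≤ lam * a s + p * (η * (a s + b s) + d) := by
    intro s hs
    have e1 : act N₁ (e (s + 1)) = act N₁ (act E (e s))
        + act N₁ (act G₁ (e s) + act G₂ (z s) + d₁ s) := by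
      rw [he, ← act_add]; congr 1; abel
    calc a (s + 1) ≤ ‖act N₁ (act E (e s))‖
          + ‖act N₁ (act G₁ (e s) + act G₂ (z s) + d₁ s)‖ := by
          simp only [ha, e1]; exact norm_add_le _ _
      _ ≤ lam * a s + p * ‖act G₁ (e s) + act G₂ (z s) + d₁ s‖ :=
          add_le_add (hE _).2.2 (hE _).2.1
      _ ≤ lam * a s + p * (η * (a s + b s) + d) := by
          gcongr
          refine (norm_add₃_le).trans ?_
          have i1 : ‖act G₁ (e s)‖ ≤ η * a s := (norm_act_le _ _).trans
            (mul_le_mul hG₁ (hea s) (norm_nonneg _) hη0.le)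
          have i2 : ‖act G₂ (z s)‖ ≤ η * b s := (norm_act_le _ _).trans
            (mul_le_mul hG₂ (hzb s) (norm_nonneg _) hη0.le)
          linarith [(hdt s hs).1]
  have hstep_b : ∀ s < t, b (s + 1) ≤ lam * b s + p * (η * b s + h * a s + d) := by
    intro s hs
    have e1 : act N₂ (z (s + 1)) = act N₂ (act F (z s))
        + act N₂ (act G₃ (z s) + act H (e s) + d₂ s) := by
      rw [hz, ← act_add]; congr 1; abel
    calc b (s + 1) ≤ ‖act N₂ (act F (z s))‖
          + ‖act N₂ (act G₃ (z s) + act H (e s) + d₂ s)‖ := by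
          simp only [hb, e1]; exact norm_add_le _ _
      _ ≤ lam * b s + p * ‖act G₃ (z s) + act H (e s) + d₂ s‖ :=
          add_le_add (hF _).2.2 (hF _).2.1
      _ ≤ lam * b s + p * (η * b s + h * a s + d) := by
          gcongr
          refine (norm_add₃_le).trans ?_
          have i1 : ‖act G₃ (z s)‖ ≤ η * b s := (norm_act_le _ _).trans
            (mul_le_mul hG₃ (hzb s) (norm_nonneg _) hη0.le)
          have i2 : ‖act H (e s)‖ ≤ h * a s := (norm_act_le _ _).trans
            (mul_le_mul hH (hea s) (norm_nonneg _) hh)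
          linarith [(hdt s hs).2]
  set V : ℕ → ℝ := fun t => b t + κ * a t with hV
  have habV : ∀ s, a s + b s ≤ V s := fun s => by
    simp only [hV]; nlinarith [ha0 s]
  have hVstep : ∀ s < t, V (s + 1) ≤ μ * V s + (1 + κ) * p * d := by
    intro s hs
    have i1 := hstep_a s hs
    have i2 := hstep_b s hs
    have i3 : κ * a (s + 1) ≤ κ * (lam * a s + p * (η * (a s + b s) + d)) := by gcongr
    have i4 : p * h * a s ≤ (1 - lam) / 2 * κ * a s := by gcongr
    have i5 : (1 + κ) * p * η * (a s + b s) ≤ (1 - lam) / 4 * V s := by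
      rw [hηe]; gcongr; exact habV s
    have i6 : 0 ≤ p * η * a s := mul_nonneg (by positivity) (ha0 s)
    have i7 : (1 - lam) / 2 * κ * a s ≤ (1 - lam) / 2 * V s := by
      rw [mul_assoc]; gcongr; simp only [hV]; linarith [hb0 s]
    have i8 : μ * V s = lam * b s + κ * (lam * a s) + (1 - lam) / 2 * V s + (1 - lam) / 4 * V s := by
      simp only [hV, hμ]; ring
    rw [i8]
    simp only [hV] at *
    nlinarith
  have hVt := geometric_bound hμ0.le hμ1 (by positivity) hVstep
  have hV0 : V 0 ≤ κ * p * ‖e 0‖ := by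
    have : act N₂ (z 0) = 0 := by rw [hz0]; simp [act]
    simp only [hV, hb, this, norm_zero, zero_add, mul_assoc]
    gcongr
    exact (hE _).2.1
  have hμ' : 0 < 1 - μ := by linarith
  calc ‖e t‖ + ‖z t‖ ≤ V t := by linarith [hea t, hzb t, habV t]
    _ ≤ μ ^ t * V 0 + (1 + κ) * p * d / (1 - μ) := hVt
    _ ≤ μ ^ t * (κ * p * ‖e 0‖) + (1 + κ) * p * d / (1 - μ) := by gcongr
    _ ≤ (κ * p + (1 + κ) * p / (1 - μ)) * (μ ^ t * ‖e 0‖ + d) := by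
        have j1 : 0 ≤ κ * p * d := by positivity
        have j2 : 0 ≤ (1 + κ) * p / (1 - μ) * (μ ^ t * ‖e 0‖) := by positivity
        have j3 : (1 + κ) * p * d / (1 - μ) = (1 + κ) * p / (1 - μ) * d := by ring
        rw [j3]
        linarith

/-! ### Comparison functions -/

lemma classK_linear {c : ℝ} (hc : 0 < c) : ClassK fun s => c * s where
  cont := by fun_prop
  mono := fun a _ b _ h => mul_lt_mul_of_pos_left h hc
  zero := mul_zero c

lemma classKL_exponential {c μ : ℝ} (hc : 0 < c) (h0 : 0 < μ) (h1 : μ < 1) :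
    ClassKL fun s t => c * μ ^ t * s where
  classK := fun t => classK_linear (by positivity)
  anti := fun s hs a b hab => by
    have := pow_le_pow_of_le_one h0.le h1.le hab
    show c * μ ^ b * s ≤ c * μ ^ a * s
    gcongr
  tendsto := fun s _ => by
    have := ((tendsto_pow_atTop_nhds_zero_of_lt_one h0.le h1).const_mul c).mul_const s
    simpa using this

lemma norm_le_supNorm {n : ℕ} (z : ℕ → Vec n) {s t : ℕ} (h : s < t) : ‖z s‖ ≤ supNorm z t :=
  le_ciSup (f := fun s : Fin t => ‖z s‖) (Set.finite_range _).bddAbove ⟨s, h⟩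

lemma supNorm_nonneg {n : ℕ} (z : ℕ → Vec n) (t : ℕ) : 0 ≤ supNorm z t :=
  Real.iSup_nonneg fun _ => norm_nonneg _

lemma supNorm_le {n : ℕ} {z : ℕ → Vec n} {c : ℝ} (hc : 0 ≤ c) (hz : BoundedBy c z) (t : ℕ) :
    supNorm z t ≤ c :=
  Real.iSup_le (fun s => hz s) hc

/-! ### Data of a noisy experiment -/

section Record

variable {T nx nu ny : ℕ} {A : Matrix (Fin nx) (Fin nx) ℝ} {B : Matrix (Fin nx) (Fin nu) ℝ}
  {C : Matrix (Fin ny) (Fin nx) ℝ}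

lemma norm_window_le {n : ℕ} {z : ℕ → Vec n} {s : ℕ} {d : ℝ} (hd : 0 ≤ d)
    (hz : ∀ j < T, ‖z (s + j)‖ ≤ d) : ‖window T s z‖ ≤ T * d := by
  rw [← norm_transpose]
  have h1 := norm_sq_le_trace_mul_transpose (window T s z)ᵀ
  have h2 : ((window T s z)ᵀ * (window T s z)ᵀᵀ).trace = ∑ j : Fin T, ‖z (s + j)‖ ^ 2 := by
    simp only [trace, Matrix.diag_apply, Matrix.mul_apply, EuclideanSpace.norm_sq_eq, window]
    simp [sq]
  have h3 : ∑ j : Fin T, ‖z (s + j)‖ ^ 2 ≤ T * d ^ 2 := by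
    calc ∑ j : Fin T, ‖z (s + j)‖ ^ 2 ≤ ∑ _j : Fin T, d ^ 2 :=
          Finset.sum_le_sum fun j _ => pow_le_pow_left₀ (norm_nonneg _) (hz j j.2) 2
      _ = T * d ^ 2 := by simp
  have h4 : (T : ℝ) ≤ (T : ℝ) ^ 2 := by exact_mod_cast Nat.le_self_pow two_ne_zero T
  refine abs_le_of_sq_le_sq' ?_ (by positivity) |>.2
  rw [h2] at h1
  nlinarith [sq_nonneg d]

lemma exists_deviation_bound (A : Matrix (Fin nx) (Fin nx) ℝ) (T : ℕ) :
    ∃ c : ℝ, 0 ≤ c ∧ ∀ (δ : ℝ) (e w : ℕ → Vec nx), (∀ t, e (t + 1) = act A (e t) + w t) →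
      e 0 = 0 → (∀ t, ‖w t‖ ≤ δ) → ∀ t ≤ T, ‖e t‖ ≤ c * δ := by
  induction T with
  | zero =>
    refine ⟨0, le_rfl, fun δ e w _ h0 _ t ht => ?_⟩
    rw [Nat.le_zero.1 ht, h0]; simp
  | succ T ih =>
    obtain ⟨c, hc, h⟩ := ih
    refine ⟨c + ‖A‖ * c + 1, by positivity, fun δ e w he h0 hw t ht => ?_⟩
    have hδ : 0 ≤ δ := (norm_nonneg _).trans (hw 0)
    have h1 : 0 ≤ ‖A‖ * c * δ := by positivity
    have h2 : 0 ≤ c * δ := by positivity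
    rcases Nat.lt_or_ge T t with hlt | hle
    · obtain rfl : t = T + 1 := by omega
      have h3 := h δ e w he h0 hw T le_rfl
      calc ‖e (T + 1)‖ ≤ ‖A‖ * ‖e T‖ + ‖w T‖ := by
            rw [he]; exact (norm_add_le _ _).trans (by gcongr; exact norm_act_le _ _)
        _ ≤ ‖A‖ * (c * δ) + δ := by gcongr; exact hw T
        _ ≤ _ := by linarith
    · have h3 := h δ e w he h0 hw t hle
      linarith

lemma norm_fromRows_zero {a b c : Type*} [Fintype a] [Fintype b] [Fintype c] [DecidableEq a]
    [DecidableEq b] [DecidableEq c] (M : Matrix a c ℝ) :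
    ‖fromRows M (0 : Matrix b c ℝ)‖ = ‖M‖ := by
  have h := norm_transpose_mul_self (fromRows M (0 : Matrix b c ℝ))
  rw [transpose_fromRows, fromCols_mul_fromRows, Matrix.mul_zero, add_zero,
    norm_transpose_mul_self] at h
  exact ((sq_eq_sq₀ (norm_nonneg _) (norm_nonneg _)).1 h).symm

lemma norm_fromRows_zero_left {a b c : Type*} [Fintype a] [Fintype b] [Fintype c] [DecidableEq a]
    [DecidableEq b] [DecidableEq c] (M : Matrix b c ℝ) :
    ‖fromRows (0 : Matrix a c ℝ) M‖ = ‖M‖ := by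
  have h := norm_transpose_mul_self (fromRows (0 : Matrix a c ℝ) M)
  rw [transpose_fromRows, fromCols_mul_fromRows, Matrix.mul_zero, zero_add,
    norm_transpose_mul_self] at h
  exact ((sq_eq_sq₀ (norm_nonneg _) (norm_nonneg _)).1 h).symm

/-- A right inverse of a matrix with two row blocks splits into two column blocks, none of which
has a larger norm. -/
lemma exists_fromCols_of_right_inverse {a b c : Type*} [Fintype a] [Fintype b] [Fintype c]
    [DecidableEq a] [DecidableEq b] [DecidableEq c] {M : Matrix (a ⊕ b) c ℝ}
    {N : Matrix c (a ⊕ b) ℝ} (h : M * N = 1) : ∃ (N₁ : Matrix c a ℝ) (N₂ : Matrix c b ℝ),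
      M * fromCols N₁ N₂ = 1 ∧ ‖N₁‖ ≤ ‖N‖ ∧ ‖N₂‖ ≤ ‖N‖ := by
  refine ⟨N * (fromRows 1 0 : Matrix (a ⊕ b) a ℝ), N * (fromRows 0 1 : Matrix (a ⊕ b) b ℝ),
    ?_, ?_, ?_⟩
  · rw [← mul_fromCols]
    have : fromCols (fromRows (1 : Matrix a a ℝ) (0 : Matrix b a ℝ))
        (fromRows (0 : Matrix a b ℝ) (1 : Matrix b b ℝ)) = 1 := by
      rw [fromCols_fromRows_eq_fromBlocks, fromBlocks_one]
    rw [this, Matrix.mul_one, h]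
  · refine (l2_opNorm_mul _ _).trans ?_
    rw [norm_fromRows_zero]
    exact mul_le_of_le_one_right (norm_nonneg _) norm_one_le
  · refine (l2_opNorm_mul _ _).trans ?_
    rw [norm_fromRows_zero_left]
    exact mul_le_of_le_one_right (norm_nonneg _) norm_one_le

/-- The data equations `X₁ = A X₀ + B U₀ + W`, `Y₀ = C X₀ + V`. -/
structure IsNoisyData (A : Matrix (Fin nx) (Fin nx) ℝ) (B : Matrix (Fin nx) (Fin nu) ℝ)
    (C : Matrix (Fin ny) (Fin nx) ℝ) (D : Data T nx nu ny) (W : Matrix (Fin nx) (Fin T) ℝ)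
    (V : Matrix (Fin ny) (Fin T) ℝ) : Prop where
  X1_eq : D.X1 = A * D.X0 + B * D.U0 + W
  Y0_eq : D.Y0 = C * D.X0 + V

lemma IsTrajectory.isNoisyData {x w : ℕ → Vec nx} {u : ℕ → Vec nu} {y v : ℕ → Vec ny}
    (h : IsTrajectory A B C x u y w v) :
    IsNoisyData A B C (Data.ofTraj T x u y) (window T 0 w) (window T 0 v) := by
  constructor
  · ext i j
    have := congrArg (fun z : Vec nx => z i) (h j).1
    simpa [Data.ofTraj, window, add_comm 1 (j : ℕ), Matrix.mul_apply, act_eq, mulVec,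
      dotProduct] using this
  · ext i j
    have := congrArg (fun z : Vec ny => z i) (h j).2
    simpa [Data.ofTraj, window, Matrix.mul_apply, act_eq, mulVec, dotProduct] using this

/-- For small noise all records have a right inverse of `Φ₀` with a common norm bound: `Φ₀` is
close to the noise-free data matrix, which has full row rank. -/
lemma exists_uniform_right_inverse (hAB : Controllable A B) (x₀ : Vec nx) {ud : ℕ → Vec nu}
    (hPE : PersistentlyExciting (nx + 1) T ud) (C : Matrix (Fin ny) (Fin nx) ℝ) :
    ∃ r δ₁ : ℝ, 0 ≤ r ∧ 0 < δ₁ ∧ ∀ δ, 0 ≤ δ → δ ≤ δ₁ →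
      ∀ (x w : ℕ → Vec nx) (y v : ℕ → Vec ny), IsTrajectory A B C x ud y w v → x 0 = x₀ →
        BoundedBy δ w → ∃ (Φ₁ : Matrix (Fin T) (Fin nx) ℝ) (Φ₂ : Matrix (Fin T) (Fin nu) ℝ),
          (Data.ofTraj T x ud y).Phi0 * fromCols Φ₁ Φ₂ = 1 ∧ ‖Φ₁‖ ≤ r ∧ ‖Φ₂‖ ≤ r := by
  let xb : ℕ → Vec nx := fun t => Nat.rec x₀ (fun t xt => act A xt + act B (ud t)) t
  have hxb : ∀ t, xb (t + 1) = act A (xb t) + act B (ud t) := fun t => rfl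
  set M : Matrix (Fin nx ⊕ Fin nu) (Fin T) ℝ := fromRows (window T 0 xb) (window T 0 ud) with hM
  have hker : ∀ a, a ᵥ* M = 0 → a = 0 := by
    intro a h
    obtain ⟨h1, h2⟩ := eq_zero_of_annihilates_samples hAB (T := T) (x := fun t => (xb t).ofLp)
      (u := ud) (fun t => by simp [hxb, act_eq]) hPE (ξ := a ∘ Sum.inl) (η := a ∘ Sum.inr) (by
        intro t ht
        have := congrFun h ⟨t, ht⟩
        simpa [hM, vecMul, dotProduct, window] using this)
    ext (i | i)
    · exact congrFun h1 i
    · exact congrFun h2 i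
  obtain ⟨N, hN⟩ := exists_right_inverse_of_vecMul hker
  obtain ⟨η, hη, hnear⟩ := exists_right_inverse_of_near hN
  obtain ⟨c, hc, hdev⟩ := exists_deviation_bound A T
  refine ⟨2 * ‖N‖, η / (T * c + 1), by positivity, by positivity,
    fun δ hδ0 hδ x w y v hx hx0 hw => ?_⟩
  have hdt : ∀ t ≤ T, ‖x t - xb t‖ ≤ c * δ :=
    hdev δ (fun t => x t - xb t) w
      (fun t => by simp only [(hx t).1, hxb, act_sub]; abel)
      (by simp [hx0, xb]) hw
  have hdiff : (Data.ofTraj T x ud y).Phi0 - M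
      = fromRows (window T 0 fun t => x t - xb t) (0 : Matrix (Fin nu) (Fin T) ℝ) := by
    ext (i | i) j <;> simp [Data.Phi0, Data.ofTraj, hM, window]
  obtain ⟨N', hN', hN'n⟩ := hnear (Data.ofTraj T x ud y).Phi0 (by
    rw [hdiff, norm_fromRows_zero]
    calc _ ≤ T * (c * δ) :=
          norm_window_le (by positivity) fun j hj => by simpa using hdt j hj.le
      _ ≤ (T * c + 1) * δ := by linarith
      _ ≤ (T * c + 1) * (η / (T * c + 1)) := by gcongr
      _ = η := by field_simp)
  obtain ⟨N₁, N₂, h1, h2, h3⟩ := exists_fromCols_of_right_inverse hN'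
  exact ⟨N₁, N₂, h1, h2.trans hN'n, h3.trans hN'n⟩

end Record

/-! ### Feasible points with uniformly bounded costs -/

section Feasible

variable {T nx nu ny : ℕ} {A : Matrix (Fin nx) (Fin nx) ℝ} {B : Matrix (Fin nx) (Fin nu) ℝ}
  {C : Matrix (Fin ny) (Fin nx) ℝ} {D : Data T nx nu ny} {W : Matrix (Fin nx) (Fin T) ℝ}
  {V : Matrix (Fin ny) (Fin T) ℝ}

lemma trace_le_card_mul_norm {n : Type*} [Fintype n] [DecidableEq n] {M : Matrix n n ℝ}
    (hM : Mᵀ = M) : M.trace ≤ Fintype.card n * ‖M‖ := by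
  have := trace_le_trace_of_sub (posSemidef_smul_one_sub hM le_rfl)
  rw [trace_smul, trace_one, smul_eq_mul] at this
  linarith

lemma IsNoisyData.X1_mul (hD : IsNoisyData A B C D W V) {K : Matrix (Fin nu) (Fin nx) ℝ}
    {S : Matrix (Fin T) (Fin nx) ℝ} (h0 : D.X0 * S = 1) (hU : D.U0 * S = K) :
    D.X1 * S = A + B * K + W * S := by
  rw [hD.X1_eq, Matrix.add_mul, Matrix.add_mul, Matrix.mul_assoc A, Matrix.mul_assoc B, h0, hU,
    Matrix.mul_one]

lemma IsNoisyData.innovation_mul (hD : IsNoisyData A B C D W V) (L : Matrix (Fin nx) (Fin ny) ℝ)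
    {Φ₁ : Matrix (Fin T) (Fin nx) ℝ} (h0 : D.X0 * Φ₁ = 1) (hU : D.U0 * Φ₁ = 0) :
    (D.X1 - L * D.Y0) * Φ₁ = A - L * C + (W - L * V) * Φ₁ := by
  rw [Matrix.sub_mul, hD.X1_mul h0 hU, hD.Y0_eq, Matrix.mul_assoc L, Matrix.add_mul,
    Matrix.mul_assoc C, h0, Matrix.mul_zero, Matrix.mul_one, Matrix.mul_add, Matrix.sub_mul,
    Matrix.mul_assoc L V]
  abel

/-- The quadratic form in the observer program, for `Π = Σ L`. -/
lemma observer_quadratic_eq {S : Matrix (Fin nx) (Fin nx) ℝ} (hS : (S - 1).PosSemidef)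
    (L : Matrix (Fin nx) (Fin ny) ℝ) (Φ₁ : Matrix (Fin T) (Fin nx) ℝ) :
    Φ₁ᵀ * (S * D.X1 - S * L * D.Y0)ᵀ * S⁻¹ * (S * D.X1 - S * L * D.Y0) * Φ₁
      = ((D.X1 - L * D.Y0) * Φ₁)ᵀ * S * ((D.X1 - L * D.Y0) * Φ₁) := by
  have hSs : Sᵀ = S := (posDef_of_sub_one hS).posSemidef.isHermitian
  rw [Matrix.mul_assoc S L, ← Matrix.mul_sub, Matrix.transpose_mul, hSs, Matrix.transpose_mul]
  have h1 : S * S⁻¹ * S = S := by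
    rw [Matrix.mul_nonsing_inv S (isUnit_det_of_sub_one hS), Matrix.one_mul]
  calc _ = Φ₁ᵀ * (D.X1 - L * D.Y0)ᵀ * (S * S⁻¹ * S) * ((D.X1 - L * D.Y0) * Φ₁) := by
        simp only [Matrix.mul_assoc]
    _ = _ := by rw [h1]

variable {Wx : Matrix (Fin nx) (Fin nx) ℝ} {Wu : Matrix (Fin nu) (Fin nu) ℝ} {α₁ : ℝ}

/-- A stabilising gain `K` with a certificate `P` that holds for closed-loop matrices `η`-close to
`A + B K` gives a feasible point of the state-feedback program, whose cost is bounded in terms of a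
bound `r` for the right inverse `[Φ₁ Φ₂]`. -/
lemma LQRFeasible.exists_of_certificate (hD : IsNoisyData A B C D W V)
    {P : Matrix (Fin nx) (Fin nx) ℝ} {K : Matrix (Fin nu) (Fin nx) ℝ} {η r : ℝ}
    (hP : (P - 1).PosSemidef)
    (hη : ∀ F, ‖F - (A + B * K)‖ ≤ η → (-(F * P * Fᵀ - P + 1)).PosSemidef)
    {Φ₁ : Matrix (Fin T) (Fin nx) ℝ} {Φ₂ : Matrix (Fin T) (Fin nu) ℝ}
    (hΦ : D.Phi0 * fromCols Φ₁ Φ₂ = 1) (h1 : ‖Φ₁‖ ≤ r) (h2 : ‖Φ₂‖ ≤ r)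
    (hW : ‖W‖ * (r * (1 + ‖K‖)) ≤ η) (hα₁ : 0 < α₁) :
    ∃ s, LQRFeasible D Wx Wu α₁ s ∧ s.γ ≤ (Wx * P).trace + (Wu * (K * P * Kᵀ)).trace
      + α₁ * (T * ((r * (1 + ‖K‖)) ^ 2 * ‖P‖)) := by
  obtain ⟨g1, g2, g3, g4⟩ := Phi0_mul_fromCols_eq_one_iff.1 hΦ
  set S := Φ₁ + Φ₂ * K with hS
  have hX0 : D.X0 * S = 1 := by
    rw [hS, Matrix.mul_add, ← Matrix.mul_assoc, g1, g2, Matrix.zero_mul, add_zero]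
  have hU0 : D.U0 * S = K := by
    rw [hS, Matrix.mul_add, ← Matrix.mul_assoc, g3, g4, Matrix.one_mul, zero_add]
  have hSn : ‖S‖ ≤ r * (1 + ‖K‖) := by
    calc ‖S‖ ≤ ‖Φ₁‖ + ‖Φ₂‖ * ‖K‖ :=
          (norm_add_le _ _).trans (by gcongr; exact l2_opNorm_mul _ _)
      _ ≤ r + r * ‖K‖ := by gcongr
      _ = _ := by ring
  have hPs : Pᵀ = P := (posDef_of_sub_one hP).posSemidef.isHermitian
  have hQ : S * P * P⁻¹ = S := by
    rw [Matrix.mul_assoc, Matrix.mul_nonsing_inv P (isUnit_det_of_sub_one hP), Matrix.mul_one]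
  have hQQ : S * P * P⁻¹ * (S * P)ᵀ = S * P * Sᵀ := by
    rw [hQ, Matrix.transpose_mul, hPs, Matrix.mul_assoc]
  have hXS := hD.X1_mul hX0 hU0
  have hmid : ∀ {k : ℕ} (Y : Matrix (Fin k) (Fin T) ℝ),
      Y * (S * P) * P⁻¹ * (S * P)ᵀ * Yᵀ = (Y * S) * P * (Y * S)ᵀ := by
    intro k Y
    calc _ = Y * (S * P * P⁻¹ * (S * P)ᵀ) * Yᵀ := by simp only [Matrix.mul_assoc]
      _ = _ := by rw [hQQ]; simp only [Matrix.transpose_mul, Matrix.mul_assoc]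
  refine ⟨⟨(Wx * P).trace + (Wu * (K * P * Kᵀ)).trace + α₁ * (S * P * Sᵀ).trace,
    S * P, P, K * P * Kᵀ, S * P * Sᵀ⟩, ⟨?_, hP, ?_, ?_, ?_, le_rfl⟩, ?_⟩
  · simp only [hmid]
    refine hη _ ?_
    rw [hXS, add_sub_cancel_left]
    exact (l2_opNorm_mul _ _).trans ((by gcongr : ‖W‖ * ‖S‖ ≤ ‖W‖ * _).trans hW)
  · simp only [hmid, hU0, sub_self]
    exact PosSemidef.zero
  · simp only [hQQ, sub_self]
    exact PosSemidef.zero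
  · simp only [← Matrix.mul_assoc, hX0, Matrix.one_mul]
  · have hsym : (S * P * Sᵀ)ᵀ = S * P * Sᵀ := by
      simp only [Matrix.transpose_mul, Matrix.transpose_transpose, hPs, Matrix.mul_assoc]
    have ht := trace_le_card_mul_norm hsym
    rw [Fintype.card_fin] at ht
    have hn : ‖S * P * Sᵀ‖ ≤ (r * (1 + ‖K‖)) ^ 2 * ‖P‖ := by
      calc ‖S * P * Sᵀ‖ ≤ ‖S‖ * ‖P‖ * ‖Sᵀ‖ :=
            (l2_opNorm_mul _ _).trans (by gcongr; exact l2_opNorm_mul _ _)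
        _ = ‖S‖ ^ 2 * ‖P‖ := by rw [norm_transpose]; ring
        _ ≤ _ := by gcongr
    simp only
    gcongr
    exact ht.trans (by gcongr)

lemma LQGFeasible.exists_of_certificate {Nx : Matrix (Fin nx) (Fin nx) ℝ}
    {Ny : Matrix (Fin ny) (Fin ny) ℝ} {α₂ : ℝ} (hD : IsNoisyData A B C D W V)
    {S : Matrix (Fin nx) (Fin nx) ℝ} {L : Matrix (Fin nx) (Fin ny) ℝ} {η : ℝ}
    (hS : (S - 1).PosSemidef)
    (hη : ∀ F, ‖F - (A - L * C)ᵀ‖ ≤ η → (-(F * S * Fᵀ - S + 1)).PosSemidef)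
    {Φ₁ : Matrix (Fin T) (Fin nx) ℝ} (h0 : D.X0 * Φ₁ = 1) (hU : D.U0 * Φ₁ = 0)
    (hWV : ‖(W - L * V) * Φ₁‖ ≤ η) :
    LQGFeasible D Φ₁ Nx Ny α₂ ⟨(Nx * S).trace + (Ny * ((S * L)ᵀ * S⁻¹ * (S * L))).trace
      + α₂ * (specNorm ((S * L)ᵀ * S⁻¹ * (S * L)) + specNorm S + specNorm (S * L)),
      S * L, S, (S * L)ᵀ * S⁻¹ * (S * L)⟩ := by
  refine ⟨?_, hS, ?_, le_rfl⟩
  · simp only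
    rw [observer_quadratic_eq hS, hD.innovation_mul L h0 hU]
    have := hη (A - L * C + (W - L * V) * Φ₁)ᵀ (by
      rw [← Matrix.transpose_sub, add_sub_cancel_left, norm_transpose]; exact hWV)
    rwa [transpose_transpose] at this
  · simp only [sub_self]
    exact PosSemidef.zero

end Feasible

/-! ### The closed loop as a perturbed cascade -/

section Loop

variable {T nx nu ny : ℕ} {A : Matrix (Fin nx) (Fin nx) ℝ} {B : Matrix (Fin nx) (Fin nu) ℝ}
  {C : Matrix (Fin ny) (Fin nx) ℝ} {D : Data T nx nu ny} {W : Matrix (Fin nx) (Fin T) ℝ}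
  {V : Matrix (Fin ny) (Fin T) ℝ}

/-- Estimation error and estimate obey the cascade formed by the two matrices certified by the
observer and the state-feedback programs, up to terms that are linear in the offline noise. -/
lemma ClosedLoop.cascade (hD : IsNoisyData A B C D W V) {Φ₁ : Matrix (Fin T) (Fin nx) ℝ}
    {Φ₂ : Matrix (Fin T) (Fin nu) ℝ} (hΦ : D.Phi0 * fromCols Φ₁ Φ₂ = 1)
    {K : Matrix (Fin nu) (Fin nx) ℝ} {S : Matrix (Fin T) (Fin nx) ℝ} (hS0 : D.X0 * S = 1)
    (hSU : D.U0 * S = K) {L : Matrix (Fin nx) (Fin ny) ℝ} {x xh w : ℕ → Vec nx}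
    {v : ℕ → Vec ny} (h : ClosedLoop A B C D Φ₁ Φ₂ K L x xh w v) :
    xh 0 = 0 ∧
    (∀ t, x (t + 1) - xh (t + 1) = act ((D.X1 - L * D.Y0) * Φ₁) (x t - xh t)
      + act (-((W - L * V) * Φ₁)) (x t - xh t)
      + act (-((W - L * V) * Φ₁ + W * Φ₂ * K)) (xh t) + (w t - act L (v t))) ∧
    (∀ t, xh (t + 1) = act (D.X1 * S) (xh t)
      + act ((W - L * V) * Φ₁ + W * Φ₂ * K - W * S) (xh t)
      + act (L * C) (x t - xh t) + act L (v t)) := by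
  obtain ⟨u, y, hx, h0, hxh⟩ := h
  obtain ⟨g1, g2, g3, g4⟩ := Phi0_mul_fromCols_eq_one_iff.1 hΦ
  have hE := hD.innovation_mul L g1 g3
  have hF := hD.X1_mul hS0 hSU
  have hX2 : D.X1 * Φ₂ = B + W * Φ₂ := by
    rw [hD.X1_eq, Matrix.add_mul, Matrix.add_mul, Matrix.mul_assoc A, Matrix.mul_assoc B, g2, g4,
      Matrix.mul_one, Matrix.mul_zero, zero_add]
  have hM : D.X1 * Φ₁ + D.X1 * Φ₂ * K - L * D.Y0 * Φ₁
      = A - L * C + (W - L * V) * Φ₁ + (B + W * Φ₂) * K := by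
    rw [← hE, ← hX2, Matrix.sub_mul]; abel
  have hstep : ∀ t, xh (t + 1) = act (A - L * C + (W - L * V) * Φ₁ + (B + W * Φ₂) * K) (xh t)
      + act L (act C (x t) + v t) := fun t => by
    rw [(hxh t).1, hM, (hx t).2]
  refine ⟨h0, fun t => ?_, fun t => ?_⟩
  · rw [(hx t).1, (hxh t).2, hstep, hE]
    simp only [add_act, sub_act, neg_act, mul_act, act_add, act_sub]
    abel
  · rw [hstep, hF]
    simp only [add_act, sub_act, mul_act, act_add, act_sub]
    abel

/-- An exponential bound with linear gains yields both stability notions. -/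
lemma rges_and_isps_of_bound
    {loop : (ℕ → Vec nx) → (ℕ → Vec nx) → (ℕ → Vec nx) → (ℕ → Vec ny) → Prop}
    {wbar vbar c μ l : ℝ} (hv : 0 ≤ vbar) (hc : 0 < c) (hμ0 : 0 < μ) (hμ1 : μ < 1) (hl : 0 ≤ l)
    (h : ∀ x xh w v, loop x xh w v → xh 0 = 0 ∧ ∀ t,
      ‖x t - xh t‖ + ‖xh t‖ ≤ c * (μ ^ t * ‖x 0 - xh 0‖ + (supNorm w t + l * supNorm v t))) :
    RGES wbar vbar loop ∧ ISpS vbar loop := by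
  refine ⟨⟨fun s t => c * μ ^ t * s, fun s => c * s, fun s => (c * (l + 1)) * s,
      classKL_exponential hc hμ0 hμ1, classK_linear hc, classK_linear (by positivity), ?_⟩,
    ⟨fun s t => c * μ ^ t * s, fun s => c * s, c * (l * vbar),
      classKL_exponential hc hμ0 hμ1, classK_linear hc, ?_⟩⟩
  · intro x xh w v hloop _ _ t
    have h1 := (h x xh w v hloop).2 t
    have h2 : 0 ≤ c * supNorm v t := mul_nonneg hc.le (supNorm_nonneg v t)
    have h3 := norm_nonneg (xh t)
    simp only
    linarith
  · intro x xh w v hloop _ hvb t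
    obtain ⟨h0, hb⟩ := h x xh w v hloop
    have h1 := hb t
    rw [h0, sub_zero] at h1
    have h2 : c * (l * supNorm v t) ≤ c * (l * vbar) := by
      gcongr; exact supNorm_le hv hvb t
    have h3 : ‖x t‖ ≤ ‖x t - xh t‖ + ‖xh t‖ := by
      simpa using norm_add_le (x t - xh t) (xh t)
    simp only
    linarith

end Loop

/-! ### Choice of the noise level -/

lemma LQRFeasible.lyapunov {T nx nu ny : ℕ} {D : Data T nx nu ny} {Wx : Matrix (Fin nx) (Fin nx) ℝ}
    {Wu : Matrix (Fin nu) (Fin nu) ℝ} {α₁ : ℝ} {s : LQRVar T nx nu}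
    (hs : LQRFeasible D Wx Wu α₁ s) :
    (s.P - 1 - (D.X1 * (s.Q * s.P⁻¹)) * s.P * (D.X1 * (s.Q * s.P⁻¹))ᵀ).PosSemidef := by
  have h := hs.lyap
  have e : D.X1 * s.Q * s.P⁻¹ * s.Qᵀ * D.X1ᵀ
      = (D.X1 * (s.Q * s.P⁻¹)) * s.P * (D.X1 * (s.Q * s.P⁻¹))ᵀ := by
    calc _ = D.X1 * (s.Q * s.P⁻¹ * s.Qᵀ) * D.X1ᵀ := by simp only [Matrix.mul_assoc]
      _ = _ := by
        rw [mul_inv_mul_eq hs.P_ge]; simp only [Matrix.transpose_mul, Matrix.mul_assoc]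
  rw [← e]
  convert h using 1
  abel

lemma LQGFeasible.lyapunov {T nx nu ny : ℕ} {D : Data T nx nu ny}
    {Φ₁ : Matrix (Fin T) (Fin nx) ℝ} {Nx : Matrix (Fin nx) (Fin nx) ℝ}
    {Ny : Matrix (Fin ny) (Fin ny) ℝ} {α₂ : ℝ} {q : LQGVar nx ny}
    (hq : LQGFeasible D Φ₁ Nx Ny α₂ q) :
    (q.Sig - 1 - ((D.X1 - q.gain * D.Y0) * Φ₁)ᵀ * q.Sig
      * ((D.X1 - q.gain * D.Y0) * Φ₁)).PosSemidef := by
  have h := hq.lyap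
  have e : q.Pi = q.Sig * q.gain := by
    rw [LQGVar.gain, ← Matrix.mul_assoc, Matrix.mul_nonsing_inv _ (isUnit_det_of_sub_one hq.Sig_ge),
      Matrix.one_mul]
  rw [e, observer_quadratic_eq hq.Sig_ge] at h
  convert h using 1
  abel

lemma eventually_mul_le (c : ℝ) {η : ℝ} (hη : 0 < η) : ∀ᶠ δ in 𝓝[>] (0 : ℝ), δ * c ≤ η := by
  have h : Tendsto (fun δ : ℝ => δ * c) (𝓝[>] 0) (𝓝 0) := by
    have : Tendsto (fun δ : ℝ => δ * c) (𝓝 0) (𝓝 (0 * c)) :=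
      tendsto_id.mul tendsto_const_nhds
    rw [zero_mul] at this
    exact this.mono_left nhdsWithin_le_nhds
  exact (h.eventually_lt_const hη).mono fun _ => le_of_lt

end DDLQG

open DDLQG Matrix in
open scoped Matrix.Norms.L2Operator in
theorem mainTheorem4 {nx nu ny : ℕ}
    (A : Matrix (Fin nx) (Fin nx) ℝ) (B : Matrix (Fin nx) (Fin nu) ℝ)
    (C : Matrix (Fin ny) (Fin nx) ℝ)
    (hAB : DDLQG.Controllable A B) (hAC : DDLQG.Observable A C)
    -- the offline experiment: length, initial state and input
    (T : ℕ) (x₀ : DDLQG.Vec nx) (ud : ℕ → DDLQG.Vec nu)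
    (hPE : DDLQG.PersistentlyExciting (nx + 1) T ud)
    -- weights and design parameters
    (Wx : Matrix (Fin nx) (Fin nx) ℝ) (Wu : Matrix (Fin nu) (Fin nu) ℝ)
    (Nx : Matrix (Fin nx) (Fin nx) ℝ) (Ny : Matrix (Fin ny) (Fin ny) ℝ)
    (hWx : Wx.PosDef) (hWu : Wu.PosDef) (hNx : Nx.PosSemidef) (hNy : Ny.PosSemidef)
    (α₁ α₂ : ℝ) (hα₁ : 0 < α₁) (hα₂ : 0 < α₂) :
    ∃ R₀ : ℝ, ∀ R : ℝ, R₀ ≤ R → ∃ δ : ℝ, 0 < δ ∧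
      ∀ wbar vbar : ℝ, 0 ≤ wbar → 0 ≤ vbar → max wbar vbar ≤ δ →
      -- every offline record with noise bounded by `wbar`, `vbar`
      ∀ (xd : ℕ → DDLQG.Vec nx) (yd : ℕ → DDLQG.Vec ny) (wd : ℕ → DDLQG.Vec nx)
        (vd : ℕ → DDLQG.Vec ny),
      DDLQG.IsTrajectory A B C xd ud yd wd vd → xd 0 = x₀ →
      DDLQG.BoundedBy wbar wd → DDLQG.BoundedBy vbar vd →
      ∀ D : DDLQG.Data T nx nu ny, D = DDLQG.Data.ofTraj T xd ud yd →
      -- rank condition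
      D.Phi0.rank = nx + nu ∧
      -- the programs are feasible and have optimal solutions
      (∃ s, DDLQG.LQRFeasible D Wx Wu α₁ s) ∧
      (∃ s, DDLQG.IsOptimal (DDLQG.LQRFeasible D Wx Wu α₁) DDLQG.LQRVar.γ s) ∧
      (∃ p, DDLQG.PhiFeasible D p) ∧
      (∃ p, DDLQG.IsOptimal (DDLQG.PhiFeasible D) DDLQG.PhiVar.ρ p ∧ DDLQG.specNorm p.Φ₂ ≤ R) ∧
      (∀ p, DDLQG.IsOptimal (DDLQG.PhiFeasible D) DDLQG.PhiVar.ρ p →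
        (∃ q, DDLQG.LQGFeasible D p.Φ₁ Nx Ny α₂ q) ∧
        (∃ q, DDLQG.IsOptimal (DDLQG.LQGFeasible D p.Φ₁ Nx Ny α₂) DDLQG.LQGVar.ε q)) ∧
      -- stability of the closed loop for all optimal solutions
      (∀ s p q, DDLQG.IsOptimal (DDLQG.LQRFeasible D Wx Wu α₁) DDLQG.LQRVar.γ s →
        DDLQG.IsOptimal (DDLQG.PhiFeasible D) DDLQG.PhiVar.ρ p → DDLQG.specNorm p.Φ₂ ≤ R →
        DDLQG.IsOptimal (DDLQG.LQGFeasible D p.Φ₁ Nx Ny α₂) DDLQG.LQGVar.ε q →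
        DDLQG.RGES wbar vbar
          (DDLQG.ClosedLoop A B C D p.Φ₁ p.Φ₂ (s.gain D) q.gain) ∧
        DDLQG.ISpS vbar
          (DDLQG.ClosedLoop A B C D p.Φ₁ p.Φ₂ (s.gain D) q.gain)) := by
  obtain ⟨r, δ₁, hr, hδ₁, hinv⟩ := exists_uniform_right_inverse (T := T) hAB x₀ hPE C
  -- certificates for the true system, valid for nearby closed-loop matrices
  obtain ⟨P₀, K₀, hP₀, hK₀⟩ := hAB.exists_lyapunov
  obtain ⟨η₂, hη₂, hmarg₂⟩ := exists_lyapunov_margin hP₀ hK₀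
  obtain ⟨S₀, L₀, hS₀, hL₀⟩ := hAC.exists_lyapunov
  obtain ⟨η₃, hη₃, hmarg₃⟩ := exists_lyapunov_margin (F := (A - L₀ * C)ᵀ) hS₀
    (by rwa [transpose_transpose])
  have two_ge : ∀ {P : Matrix (Fin nx) (Fin nx) ℝ}, (P - 1).PosSemidef →
      ((2 : ℝ) • P - 1).PosSemidef := fun {P} h => by
    have := h.add (posDef_of_sub_one h).posSemidef
    convert this using 1
    rw [two_smul]; abel
  set P := (2 : ℝ) • P₀ with hPdef
  set S := (2 : ℝ) • S₀ with hSdef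
  have hP := two_ge hP₀
  have hS := two_ge hS₀
  obtain ⟨cx, hcx0, hcx⟩ := PosDef.exists_trace_le hWx
  -- bounds, uniform over all records, for the values of the programs and for their solutions
  set γm := (Wx * P).trace + (Wu * (K₀ * P * K₀ᵀ)).trace
      + α₁ * (T * ((r * (1 + ‖K₀‖)) ^ 2 * ‖P‖)) with hγm
  set εm := (Nx * S).trace + (Ny * ((S * L₀)ᵀ * S⁻¹ * (S * L₀))).trace
      + α₂ * (specNorm ((S * L₀)ᵀ * S⁻¹ * (S * L₀)) + specNorm S + specNorm (S * L₀)) with hεm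
  set σ := √(γm / α₁) with hσ
  set k := ‖window T 0 ud‖ * σ with hk
  set l := εm / α₂ with hl
  set r₁ := (nx + 1) * r with hr₁
  set p := max 1 (max (cx * γm) l) with hp
  obtain ⟨η₄, μ, c, hη₄, hμ0, hμ1, hc, hdecay⟩ := exists_uniform_decay p (|l| * ‖C‖)
    (le_max_left _ _) (by positivity)
  refine ⟨r, fun R hR => ?_⟩
  have hR0 : 0 ≤ R := hr.trans hR
  obtain ⟨δ, ⟨⟨⟨hd1, hd2⟩, hd3⟩, hd4⟩, hδ : 0 < δ⟩ :=
    ((((eventually_mul_le 1 hδ₁).and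
      (eventually_mul_le (T * (r * (1 + ‖K₀‖))) hη₂)).and
      (eventually_mul_le (T * ((1 + ‖L₀‖) * r₁)) hη₃)).and
      (eventually_mul_le (T * ((1 + |l|) * r₁ + R * k + σ)) hη₄)).and
      self_mem_nhdsWithin |>.exists
  refine ⟨δ, hδ, fun wbar vbar hw hv hwv xd yd wd vd htraj hx0 hwd hvd D hD => ?_⟩
  have hwd' : ∀ t, ‖wd t‖ ≤ δ := fun t => (hwd t).trans ((le_max_left _ _).trans hwv)
  have hvd' : ∀ t, ‖vd t‖ ≤ δ := fun t => (hvd t).trans ((le_max_right _ _).trans hwv)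
  have hData : IsNoisyData A B C D (window T 0 wd) (window T 0 vd) := by
    rw [hD]; exact htraj.isNoisyData
  obtain ⟨Ψ₁, Ψ₂, hΨ, hΨ₁, hΨ₂⟩ := hinv δ hδ.le (by linarith) xd wd yd vd htraj hx0 hwd'
  rw [← hD] at hΨ
  set W := window T 0 wd with hWdef
  set V := window T 0 vd with hVdef
  have hWn : ‖W‖ ≤ T * δ := norm_window_le hδ.le fun j _ => hwd' _
  have hVn : ‖V‖ ≤ T * δ := norm_window_le hδ.le fun j _ => hvd' _
  have hTδ : 0 ≤ T * δ := by positivity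
  -- the offline noise enters the observer through `(W - L V) Φ₁`
  have hWLV : ∀ (L : Matrix (Fin nx) (Fin ny) ℝ) (Φ : Matrix (Fin T) (Fin nx) ℝ) (b : ℝ),
      ‖L‖ ≤ b → ‖Φ‖ ≤ r₁ → ‖(W - L * V) * Φ‖ ≤ T * δ * ((1 + b) * r₁) := by
    intro L Φ b hL hΦ
    have hb : 0 ≤ b := (norm_nonneg _).trans hL
    calc ‖(W - L * V) * Φ‖ ≤ (‖W‖ + ‖L‖ * ‖V‖) * ‖Φ‖ :=
          (l2_opNorm_mul _ _).trans (by
            gcongr; exact (norm_sub_le _ _).trans (by gcongr; exact l2_opNorm_mul _ _))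
      _ ≤ (T * δ + b * (T * δ)) * r₁ := by gcongr
      _ = _ := by ring
  -- the state-feedback program
  obtain ⟨s₀, hs₀, hs₀γ⟩ := LQRFeasible.exists_of_certificate (Wx := Wx) (Wu := Wu) hData hP hmarg₂
    hΨ hΨ₁ hΨ₂ (by
      calc _ ≤ T * δ * (r * (1 + ‖K₀‖)) := by gcongr
        _ = δ * (T * (r * (1 + ‖K₀‖))) := by ring
        _ ≤ η₂ := hd2) hα₁
  -- the right-inverse program
  have hΦ₁ : ∀ p, IsOptimal (PhiFeasible D) PhiVar.ρ p → ‖p.Φ₁‖ ≤ r₁ := by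
    intro p hp
    have h1 := hp.1.norm_sq_le.trans (hp.2 _ (PhiFeasible.of_rightInv hΨ))
    have h2 : (Ψ₁ᵀ * Ψ₁).trace ≤ nx * r ^ 2 := by
      have := trace_le_card_mul_norm (M := Ψ₁ᵀ * Ψ₁) (by simp [Matrix.transpose_mul])
      rw [Fintype.card_fin, norm_transpose_mul_self] at this
      exact this.trans (by gcongr)
    refine abs_le_of_sq_le_sq' ?_ (by positivity) |>.2
    have h3 : (nx : ℝ) * r ^ 2 ≤ (nx + 1) ^ 2 * r ^ 2 := by
      gcongr; nlinarith [(Nat.cast_nonneg nx : (0 : ℝ) ≤ nx)]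
    simp only at h1
    rw [hr₁, mul_pow]
    linarith
  -- the observer program
  have hobs : ∀ p, IsOptimal (PhiFeasible D) PhiVar.ρ p → ∃ q,
      LQGFeasible D p.Φ₁ Nx Ny α₂ q ∧ q.ε = εm := by
    intro p hp
    obtain ⟨g1, -, g3, -⟩ := Phi0_mul_fromCols_eq_one_iff.1 hp.1.rightInv
    refine ⟨_, LQGFeasible.exists_of_certificate hData hS hmarg₃ g1 g3 ?_, rfl⟩
    calc _ ≤ T * δ * ((1 + ‖L₀‖) * r₁) := hWLV _ _ _ le_rfl (hΦ₁ p hp)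
      _ = δ * (T * ((1 + ‖L₀‖) * r₁)) := by ring
      _ ≤ η₃ := hd3
  refine ⟨?_, ⟨s₀, hs₀⟩, hs₀.exists_isOptimal hWx hWu hα₁, ⟨_, PhiFeasible.of_rightInv hΨ⟩, ?_,
    ?_, ?_⟩
  · rw [rank_eq_card_of_right_inverse hΨ]; simp
  · obtain ⟨p, hp, hp2⟩ := PhiFeasible.exists_isOptimal hΨ
    exact ⟨p, hp, by rw [hp2]; exact hΨ₂.trans hR⟩
  · intro p hp
    obtain ⟨q, hq, -⟩ := hobs p hp
    exact ⟨⟨q, hq⟩, hq.exists_isOptimal hNx hNy hα₂⟩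
  · intro s pp q hs hpp hppR hq
    obtain ⟨q₀, hq₀, hq₀ε⟩ := hobs pp hpp
    have hε : q.ε ≤ εm := (hq.2 _ hq₀).trans hq₀ε.le
    have hγ : s.γ ≤ γm := (hs.2 _ hs₀).trans hs₀γ
    have hsu := isUnit_det_of_sub_one hs.1.P_ge
    -- bounds on the solution of the state-feedback program
    set Z := s.Q * s.P⁻¹ with hZ
    have hZn : ‖Z‖ ≤ σ := Real.le_sqrt_of_sq_le
      ((hs.1.norm_sq_le hWx hWu hα₁).trans (by gcongr))
    have hPn : ‖s.P‖ ≤ p := by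
      obtain ⟨h1, -, -, h2, -, -⟩ := hs.1.cost_terms hWx hWu hα₁
      calc ‖s.P‖ ≤ cx * (Wx * s.P).trace := (PosSemidef.norm_le_trace h2).trans (hcx _ h2)
        _ ≤ cx * γm := by gcongr; linarith
        _ ≤ p := (le_max_left _ _).trans (le_max_right _ _)
    have hK : s.gain D = D.U0 * Z := by rw [LQRVar.gain, hZ, Matrix.mul_assoc]
    have hKn : ‖s.gain D‖ ≤ k := by
      rw [hK, hk]
      have : D.U0 = window T 0 ud := by rw [hD]; rfl
      rw [this]
      exact (l2_opNorm_mul _ _).trans (by gcongr)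
    have hX0Z : D.X0 * Z = 1 := by
      rw [hZ, ← Matrix.mul_assoc, hs.1.X0_Q, Matrix.mul_nonsing_inv _ hsu]
    -- bounds on the solution of the observer program
    obtain ⟨-, hSn, hPin⟩ := hq.1.norm_le hNx hNy hα₂
    have hεl : q.ε / α₂ ≤ l := by rw [hl]; gcongr
    have hSp : ‖q.Sig‖ ≤ p :=
      hSn.trans (hεl.trans ((le_max_right _ _).trans (le_max_right _ _)))
    have hLn : ‖q.gain‖ ≤ |l| := by
      calc ‖q.gain‖ ≤ ‖q.Sig⁻¹‖ * ‖q.Pi‖ := l2_opNorm_mul _ _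
        _ ≤ 1 * ‖q.Pi‖ := by gcongr; exact norm_inv_le_one hq.1.Sig_ge
        _ ≤ |l| := by rw [one_mul]; exact hPin.trans (hεl.trans (le_abs_self l))
    -- the coupling terms caused by the offline noise are small
    have hb1 := hWLV q.gain pp.Φ₁ |l| hLn (hΦ₁ pp hpp)
    have hb2 : ‖W * pp.Φ₂ * s.gain D‖ ≤ T * δ * (R * k) := by
      have : ‖pp.Φ₂‖ ≤ R := hppR
      calc _ ≤ ‖W‖ * ‖pp.Φ₂‖ * ‖s.gain D‖ :=
            (l2_opNorm_mul _ _).trans (by gcongr; exact l2_opNorm_mul _ _)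
        _ ≤ T * δ * R * k := by gcongr
        _ = _ := by ring
    have hb3 : ‖W * Z‖ ≤ T * δ * σ := (l2_opNorm_mul _ _).trans (by gcongr)
    have hsum : T * δ * ((1 + |l|) * r₁) + T * δ * (R * k) + T * δ * σ ≤ η₄ := by
      refine le_trans (le_of_eq ?_) hd4
      ring
    have hn1 : 0 ≤ T * δ * (R * k) := (norm_nonneg _).trans hb2
    have hn2 : 0 ≤ T * δ * σ := (norm_nonneg _).trans hb3
    obtain ⟨N₁, hN₁⟩ := exists_contracts_of_lyapunov (le_max_left _ _) hq.1.Sig_ge hq.1.lyapunov hSp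
    obtain ⟨N₂, hN₂⟩ := exists_contracts_of_dual_lyapunov (le_max_left _ _) hs.1.P_ge
      hs.1.lyapunov hPn
    refine rges_and_isps_of_bound hv hc hμ0 hμ1 (norm_nonneg q.gain)
      fun x xh w v hloop => ?_
    obtain ⟨h0, he, hz⟩ := hloop.cascade hData hpp.1.rightInv hX0Z hK.symm
    refine ⟨h0, fun t => ?_⟩
    refine hdecay hN₁ hN₂ ?_ ?_ ?_ ?_ (fun t => x t - xh t) xh
      (fun t => w t - act q.gain (v t)) (fun t => act q.gain (v t)) he hz h0 t _ ?_ ?_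
    · rw [norm_neg]; linarith
    · rw [norm_neg]; linarith [norm_add_le ((W - q.gain * V) * pp.Φ₁) (W * pp.Φ₂ * s.gain D)]
    · linarith [norm_add_le ((W - q.gain * V) * pp.Φ₁) (W * pp.Φ₂ * s.gain D),
        norm_sub_le ((W - q.gain * V) * pp.Φ₁ + W * pp.Φ₂ * s.gain D) (W * Z)]
    · exact (l2_opNorm_mul _ _).trans (by gcongr)
    · exact add_nonneg (supNorm_nonneg w t) (mul_nonneg (norm_nonneg _) (supNorm_nonneg v t))
    · intro i hi
      have i1 := norm_le_supNorm w hi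
      have i2 : ‖act q.gain (v i)‖ ≤ ‖q.gain‖ * supNorm v t :=
        (norm_act_le _ _).trans (by gcongr; exact norm_le_supNorm v hi)
      have i3 := supNorm_nonneg w t
      exact ⟨(norm_sub_le _ _).trans (add_le_add i1 i2), by linarith⟩
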